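/- Let $d\ge 1$ and let $$K(v,w)=\int_{\{y\in\mathbb R^d:\ |y|^d\le d\,\Gamma(d/2)/(2\pi^{1+d/2})\}}\exp\bigl(2\pi i\,(v-w)\cdot y\bigr)\,\mathrm dy,\qquad v,w\in\mathbb R^d,$$ be the kernel of the stationary determinantal point process on $\mathbb R^d$ (with Lebesgue measure as reference measure) for which the Fourier transform of $K(\cdot,0)$ is the indicator function of the centred ball of volume $1/\pi$. This process has intensity $K(u,u)=1/\pi$ and is globally most repulsive, that is, $\int_{\mathbb R^d}|K(v,u)|^2/K(u,u)\,\mathrm dv=1$ for every $u\in\mathbb R^d$. For every $u\in\mathbb R^d$, the function $$\rho_u(v)=\frac{|K(v,u)|^2}{K(u,u)}=\pi|K(u,v)|^2,\qquad v\in\mathbb R^d,$$ is a probability density function on $\mathbb R^d$. In particular, for $d=2$ and every $u\in\mathbb R^2$, $$\rho_u(v)=\frac{J_1(2|v-u|)^2}{\pi|v-u|^2},\qquad v\in\mathbb R^2\setminus\{u\},\qquad \rho_u(u)=\frac1\pi,$$ where $J_1(x)=\sum_{m\ge0}\frac{(-1)^m}{m!\,(m+1)!}(x/2)^{2m+1}$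 is the Bessel function of the first kind of order one; and if $Z_u$ is a random variable in $\mathbb R^2$ with density $\rho_u$, then for every real $k\in(-2,1)$ the $k$-th moment of $|Z_u-u|$ is finite and $$\mathrm E\bigl(|Z_u-u|^k\bigr)=\frac{\Gamma(1+k/2)\,\Gamma(1-k)}{\Gamma(2-k/2)\,\Gamma(1-k/2)^2},$$ while $\mathrm E\bigl(|Z_u-u|^k\bigr)=\infty$ for every real $k\ge1$. -/

import Mathlib

open MeasureTheory

/-- The Bessel function of the first kind `J_n` of integer order `n ≥ 0` on the real line:
`J_n(x) = ∑ₘ (-1)ᵐ / (m! (m+n)!) (x/2)^(2m+n)` (an everywhere absolutely convergent series). -/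
noncomputable def besselJ (n : ℕ) (x : ℝ) : ℝ :=
  ∑' m : ℕ, (-1 : ℝ) ^ m / ((m.factorial : ℝ) * ((m + n).factorial : ℝ)) * (x / 2) ^ (2 * m + n)

/-- For a determinantal point process with kernel `K`, the intensity function
`ρ_u(v) = |K(v,u)|² / K(u,u)` of the points pushed out by a point at `u`
(`K u u` is real for a Hermitian kernel). -/
noncomputable def pushedOutIntensity {E : Type*} (K : E → E → ℂ) (u v : E) : ℝ :=
  ‖K v u‖ ^ 2 / (K u u).re

/-- `f` is a probability density function with respect to the reference measure. -/
def IsProbabilityDensity {E : Type*} [MeasureSpace E] (f : E → ℝ) : Prop :=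
  Measurable f ∧ (∀ v, 0 ≤ f v) ∧ Integrable f ∧ ∫ v, f v = 1

/-- A kernel `K` is globally most repulsive if `p_u = ∫ |K(v,u)|² / K(u,u) dv` equals `1`
for all `u` with `K(u,u) > 0`. -/
def IsGloballyMostRepulsive {E : Type*} [MeasureSpace E] (K : E → E → ℂ) : Prop :=
  ∀ u, 0 < (K u u).re → ∫ v, pushedOutIntensity K u v = 1

/-- The stationary and isotropic kernel on `ℝᵈ` whose Fourier transform is the indicator of the
centred closed ball of volume `1/π`:
`K(v,w) = ∫_{|y|^d ≤ d Γ(d/2) / (2 π^(1+d/2))} exp(2πi (v-w)·y) dy`. -/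
noncomputable def ballKernel (d : ℕ) (v w : EuclideanSpace ℝ (Fin d)) : ℂ :=
  ∫ y in {y : EuclideanSpace ℝ (Fin d) |
      ‖y‖ ^ d ≤ (d : ℝ) * Real.Gamma ((d : ℝ) / 2) / (2 * Real.pi ^ (1 + (d : ℝ) / 2))},
    Complex.exp (2 * (Real.pi : ℂ) * Complex.I * ((inner ℝ (v - w) y : ℝ) : ℂ))

/-- The function `ρ_u(v) = π |K(u,v)|²` for the kernel `ballKernel d`. -/
noncomputable def ballDensity (d : ℕ) (u v : EuclideanSpace ℝ (Fin d)) : ℝ :=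
  Real.pi * ‖ballKernel d u v‖ ^ 2

/-
The kernel is the translate of the Fourier transform `T` of the indicator of a ball `B`, so
Plancherel turns the mass of the density into the volume of `B`. In the plane, integrating the
exponential series over the disc term by term produces the Bessel function.

For the moments, apply Plancherel to the differences `1_B - 1_B (· + s e)`, with `e` a unit vector,
weight by `s ^ (-1 - k)` and integrate over `s > 0`. On the Fourier side this gives a multiple of
the integral of `|x · e| ^ k |T|²`. On the other side each chord of the disc in direction `e`
contributes the length of the part of it within `s / 2` of its midpoint, which gives a multiple of
the integral of `|x · e| ^ (-k)` over `B`. As `T` is radial, passing from `|x · e|` to `|x|` costs a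
moment of the cosine on each side, known from the duplication formula: hence the closed form for
`0 < k < 1`, and divergence at `k = 1`, where the moment of order `-1` of the cosine is infinite.
Finally `k ↦ 𝔼 |Z - u| ^ k` is real analytic on the interval of finite moments, so the closed form
extends to `-2 < k < 1`.
-/

section Plancherel

variable {V : Type*} [NormedAddCommGroup V] [InnerProductSpace ℝ V] [FiniteDimensional ℝ V]
  [MeasurableSpace V] [BorelSpace V]

open scoped FourierTransform SchwartzMap

theorem continuous_fourier {f : V → ℂ} (hf : Integrable f) : Continuous (𝓕 f) :=
  VectorFourier.fourierIntegral_continuous Real.continuous_fourierChar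
    (by exact continuous_inner) hf

-- Both sides pair in the same way with every test function `g`: the `L²` transform because it is
-- the transform of tempered distributions, the Fourier integral by Fubini.
theorem fourier_toLp_ae_eq {f : V → ℂ} (hf : Integrable f) (hf2 : MemLp f 2) :
    (𝓕 (hf2.toLp f) : Lp (α := V) ℂ 2 volume) =ᵐ[volume] 𝓕 f := by
  have hloc : LocallyIntegrable (𝓕 (hf2.toLp f) : Lp (α := V) ℂ 2 volume) volume :=
    (Lp.memLp (𝓕 (hf2.toLp f) : Lp (α := V) ℂ 2 volume)).locallyIntegrable (by norm_num)
  refine ae_eq_of_integral_contDiff_smul_eq hloc (continuous_fourier hf).locallyIntegrable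
    fun g hg hgc => ?_
  let G : 𝓢(V, ℂ) := (hgc.comp_left Complex.ofReal_zero :
    HasCompactSupport fun x => (g x : ℂ)).toSchwartzMap (Complex.ofRealCLM.contDiff.comp hg)
  have hG : ∀ x, G x = (g x : ℂ) := fun x => rfl
  have hdistribution : ∫ x, G x • (𝓕 (hf2.toLp f) : Lp (α := V) ℂ 2 volume) x =
      ∫ x, (𝓕 G) x • (hf2.toLp f) x := by
    have h := congrArg (fun T => T G) (Lp.fourier_toTemperedDistribution_eq (hf2.toLp f))
    simp only [TemperedDistribution.fourier_apply, Lp.toTemperedDistribution_apply] at h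
    exact h.symm
  have hrepr : ∫ x, (𝓕 G) x • (hf2.toLp f) x = ∫ x, (𝓕 (G : V → ℂ)) x • f x := by
    refine integral_congr_ae ?_
    filter_upwards [hf2.coeFn_toLp] with x hx
    rw [hx, SchwartzMap.fourier_coe]
  have hfubini : ∫ x, (𝓕 (G : V → ℂ)) x • f x = ∫ x, G x • 𝓕 f x := by
    simpa using! VectorFourier.integral_fourierIntegral_smul_eq_flip (L := innerₗ V)
      Real.continuous_fourierChar continuous_inner G.integrable hf
  simpa [hG] using hdistribution.trans (hrepr.trans hfubini)

theorem lintegral_enorm_sq_fourier {f : V → ℂ} (hf : Integrable f) (hf2 : MemLp f 2) :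
    ∫⁻ x, ‖𝓕 f x‖ₑ ^ 2 = ∫⁻ x, ‖f x‖ₑ ^ 2 := by
  have heLpNorm : eLpNorm (𝓕 f) 2 volume = eLpNorm f 2 volume := by
    rw [← eLpNorm_congr_ae (fourier_toLp_ae_eq hf hf2), ← Lp.enorm_def, ← ofReal_norm,
      Lp.norm_fourier_eq, ofReal_norm, Lp.enorm_def, eLpNorm_congr_ae hf2.coeFn_toLp]
  have hsq : ∀ g : V → ℂ, eLpNorm g 2 volume ^ 2 = ∫⁻ x, ‖g x‖ₑ ^ 2 := fun g => by
    simpa using eLpNorm_nnreal_pow_eq_lintegral (p := 2) (f := g) (μ := volume) (by norm_num)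
  rw [← hsq, ← hsq, heLpNorm]

theorem enorm_sq_one_sub_fourierChar (x : ℝ) :
    ‖(1 : ℂ) - Real.fourierChar x‖ₑ ^ 2 =
      ENNReal.ofReal (2 * (1 - Real.cos (2 * Real.pi * x))) := by
  rw [← ofReal_norm, ← ENNReal.ofReal_pow (norm_nonneg _), Real.fourierChar_apply,
    ← Complex.normSq_eq_norm_sq, Complex.normSq_apply]
  congr 1
  rw [Complex.sub_re, Complex.sub_im, Complex.exp_ofReal_mul_I_re, Complex.exp_ofReal_mul_I_im,
    Complex.one_re, Complex.one_im]
  linear_combination Real.sin_sq_add_cos_sq (2 * Real.pi * x)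

theorem fourier_sub_translate {f : V → ℂ} (hf : Integrable f) (h x : V) :
    𝓕 (fun y => f y - f (y + h)) x = (1 - (Real.fourierChar (inner ℝ h x) : ℂ)) * 𝓕 f x := by
  have htranslate : 𝓕 (fun y => f (y + h)) x = (Real.fourierChar (inner ℝ h x) : ℂ) * 𝓕 f x :=
    congrFun (VectorFourier.fourierIntegral_comp_add_right Real.fourierChar volume (innerₗ V) f h) x
  rw [sub_mul, one_mul, ← htranslate]
  simp only [Real.fourier_eq, smul_sub]
  exact integral_sub ((Real.fourierIntegral_convergent_iff x).2 hf)
    ((Real.fourierIntegral_convergent_iff x).2 (hf.comp_add_right h))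

theorem lintegral_enorm_sq_sub_translate {f : V → ℂ} (hf : Integrable f) (hf2 : MemLp f 2)
    (h : V) :
    ∫⁻ x, ‖f x - f (x + h)‖ₑ ^ 2 =
      ∫⁻ x, ENNReal.ofReal (2 * (1 - Real.cos (2 * Real.pi * inner ℝ h x))) * ‖𝓕 f x‖ₑ ^ 2 := by
  refine (lintegral_enorm_sq_fourier (hf.sub (hf.comp_add_right h)) (hf2.sub
    (hf2.comp_measurePreserving (measurePreserving_add_right volume h)))).symm.trans ?_
  refine lintegral_congr fun x => ?_
  rw [← enorm_sq_one_sub_fourierChar, ← mul_pow, ← enorm_mul, ← fourier_sub_translate hf]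
  rfl

end Plancherel

section FractionalDifferences

open Set

theorem lintegral_rpow_mul_exp_neg_mul_rpow {p q b : ℝ} (hp : 0 < p) (hq : -1 < q) (hb : 0 < b) :
    ∫⁻ x in Ioi (0 : ℝ), ENNReal.ofReal (x ^ q * Real.exp (-b * x ^ p)) =
      ENNReal.ofReal (b ^ (-(q + 1) / p) * (1 / p) * Real.Gamma ((q + 1) / p)) := by
  rw [← integral_rpow_mul_exp_neg_mul_rpow hp hq hb, ofReal_integral_eq_lintegral_ofReal
    (integrableOn_rpow_mul_exp_neg_mul_rpow hq hp hb)]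
  filter_upwards [ae_restrict_mem measurableSet_Ioi] with x hx
  exact mul_nonneg (Real.rpow_nonneg (le_of_lt hx) _) (Real.exp_pos _).le

theorem lintegral_rpow_mul_exp_neg_mul {q b : ℝ} (hq : -1 < q) (hb : 0 < b) :
    ∫⁻ x in Ioi (0 : ℝ), ENNReal.ofReal (x ^ q * Real.exp (-b * x)) =
      ENNReal.ofReal (b ^ (-(q + 1)) * Real.Gamma (q + 1)) := by
  simpa using lintegral_rpow_mul_exp_neg_mul_rpow one_pos hq hb

theorem lintegral_one_sub_cos_mul_exp_neg {b : ℝ} (hb : 0 < b) :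
    ∫⁻ s in Ioi (0 : ℝ), ENNReal.ofReal ((1 - Real.cos s) * Real.exp (-b * s)) =
      ENNReal.ofReal (1 / (b * (1 + b ^ 2))) := by
  have hre_real : ((-b : ℝ) : ℂ).re < 0 := by simpa using hb
  have hre_I : (((-b : ℝ) : ℂ) + Complex.I).re < 0 := by simpa using hb
  have hint_real := integrableOn_exp_mul_complex_Ioi hre_real 0
  have hint_I := integrableOn_exp_mul_complex_Ioi hre_I 0
  have hre : ∀ s : ℝ, (Complex.exp (((-b : ℝ) : ℂ) * s) -
      Complex.exp ((((-b : ℝ) : ℂ) + Complex.I) * s)).re =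
        (1 - Real.cos s) * Real.exp (-b * s) := fun s => by
    rw [Complex.sub_re, Complex.exp_re, Complex.exp_re]
    simp
    ring
  have hintegral : ∫ s in Ioi (0 : ℝ), (1 - Real.cos s) * Real.exp (-b * s) =
      1 / (b * (1 + b ^ 2)) := by
    calc ∫ s in Ioi (0 : ℝ), (1 - Real.cos s) * Real.exp (-b * s)
        = (∫ s in Ioi (0 : ℝ), (Complex.exp (((-b : ℝ) : ℂ) * s) -
            Complex.exp ((((-b : ℝ) : ℂ) + Complex.I) * s))).re := by
          simp_rw [← hre]
          exact integral_re (hint_real.sub hint_I)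
      _ = _ := by
          rw [integral_sub hint_real hint_I, integral_exp_mul_complex_Ioi hre_real,
            integral_exp_mul_complex_Ioi hre_I]
          simp [Complex.div_re, Complex.normSq_apply]
          field_simp
          ring
  rw [← hintegral, ofReal_integral_eq_lintegral_ofReal
    ((hint_real.sub hint_I).re.congr (Filter.Eventually.of_forall hre))]
  exact Filter.Eventually.of_forall fun s =>
    mul_nonneg (sub_nonneg.2 (Real.cos_le_one s)) (Real.exp_pos _).le

theorem lintegral_rpow_mul_exp_neg_one_add_sq_mul {k t : ℝ} (hk : 0 < k) (ht : 0 < t) :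
    ∫⁻ x in Ioi (0 : ℝ), ENNReal.ofReal (x ^ (k - 1) * Real.exp (-(1 + x ^ 2) * t)) =
      ENNReal.ofReal (Real.Gamma (k / 2) / 2) *
        ENNReal.ofReal (t ^ (-(k / 2)) * Real.exp (-1 * t)) := by
  have := Real.Gamma_pos_of_pos (half_pos hk)
  have hsplit : ∀ x : ℝ, ENNReal.ofReal (x ^ (k - 1) * Real.exp (-(1 + x ^ 2) * t)) =
      ENNReal.ofReal (Real.exp (-t)) *
        ENNReal.ofReal (x ^ (k - 1) * Real.exp (-t * x ^ (2 : ℝ))) := fun x => by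
    rw [← ENNReal.ofReal_mul (Real.exp_pos _).le, mul_left_comm, ← Real.exp_add, Real.rpow_two]
    ring_nf
  simp_rw [hsplit]
  rw [lintegral_const_mul' _ _ ENNReal.ofReal_ne_top,
    lintegral_rpow_mul_exp_neg_mul_rpow two_pos (by linarith) ht,
    ← ENNReal.ofReal_mul (Real.exp_pos _).le, ← ENNReal.ofReal_mul (by positivity)]
  ring_nf

theorem lintegral_rpow_div_one_add_sq {k : ℝ} (hk0 : 0 < k) (hk2 : k < 2) :
    ∫⁻ x in Ioi (0 : ℝ), ENNReal.ofReal (x ^ (k - 1) * (1 / (1 + x ^ 2))) =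
      ENNReal.ofReal (Real.Gamma (k / 2) * Real.Gamma (1 - k / 2) / 2) := by
  have := Real.Gamma_pos_of_pos (half_pos hk0)
  have hexp : ∀ x ∈ Ioi (0 : ℝ), ENNReal.ofReal (x ^ (k - 1) * (1 / (1 + x ^ 2))) =
      ∫⁻ t in Ioi (0 : ℝ), ENNReal.ofReal (x ^ (k - 1) * Real.exp (-(1 + x ^ 2) * t)) := by
    intro x hx
    have hxk : 0 ≤ x ^ (k - 1) := Real.rpow_nonneg (le_of_lt hx) _
    have hone := lintegral_rpow_mul_exp_neg_mul (q := 0) (b := 1 + x ^ 2) (by norm_num)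
      (by positivity)
    simp only [Real.rpow_zero, one_mul, zero_add, Real.Gamma_one, mul_one, Real.rpow_neg_one]
      at hone
    simp_rw [ENNReal.ofReal_mul hxk]
    rw [lintegral_const_mul' _ _ ENNReal.ofReal_ne_top, hone, one_div]
  rw [setLIntegral_congr_fun measurableSet_Ioi hexp,
    lintegral_lintegral_swap (Measurable.aemeasurable (by fun_prop)),
    setLIntegral_congr_fun measurableSet_Ioi fun t ht =>
      lintegral_rpow_mul_exp_neg_one_add_sq_mul hk0 ht,
    lintegral_const_mul' _ _ ENNReal.ofReal_ne_top,
    lintegral_rpow_mul_exp_neg_mul (by linarith) one_pos, ← ENNReal.ofReal_mul (by positivity),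
    Real.one_rpow]
  ring_nf

theorem lintegral_one_sub_cos_mul_rpow_mul_exp_neg (k : ℝ) {x : ℝ} (hx : 0 < x) :
    ∫⁻ s in Ioi (0 : ℝ), ENNReal.ofReal ((1 - Real.cos s) * (x ^ k * Real.exp (-s * x))) =
      ENNReal.ofReal (x ^ (k - 1) * (1 / (1 + x ^ 2))) := by
  have hxk : 0 ≤ x ^ k := Real.rpow_nonneg hx.le _
  have hsplit : ∀ s : ℝ, ENNReal.ofReal ((1 - Real.cos s) * (x ^ k * Real.exp (-s * x))) =
      ENNReal.ofReal (x ^ k) * ENNReal.ofReal ((1 - Real.cos s) * Real.exp (-x * s)) :=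
    fun s => by
      rw [← ENNReal.ofReal_mul hxk]
      ring_nf
  simp_rw [hsplit]
  rw [lintegral_const_mul' _ _ ENNReal.ofReal_ne_top, lintegral_one_sub_cos_mul_exp_neg hx,
    ← ENNReal.ofReal_mul hxk, Real.rpow_sub_one hx.ne']
  congr 1
  field_simp

-- Write `Γ(1 + k) s ^ (-1 - k)` as the integral of `x ^ k * exp (-s x)` and integrate in `s` first.
theorem lintegral_one_sub_cos_mul_rpow {k : ℝ} (hk0 : 0 < k) (hk2 : k < 2) :
    ∫⁻ s in Ioi (0 : ℝ), ENNReal.ofReal ((1 - Real.cos s) * s ^ (-1 - k)) =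
      ENNReal.ofReal (Real.Gamma (k / 2) * Real.Gamma (1 - k / 2) / (2 * Real.Gamma (1 + k))) := by
  have : 0 < Real.Gamma (1 + k) := Real.Gamma_pos_of_pos (by linarith)
  have hcos : ∀ s : ℝ, 0 ≤ 1 - Real.cos s := fun s => sub_nonneg.2 (Real.cos_le_one s)
  have hexp : ∀ s ∈ Ioi (0 : ℝ), ENNReal.ofReal ((1 - Real.cos s) * s ^ (-1 - k)) =
      ENNReal.ofReal (Real.Gamma (1 + k))⁻¹ * ∫⁻ x in Ioi (0 : ℝ),
        ENNReal.ofReal ((1 - Real.cos s) * (x ^ k * Real.exp (-s * x))) := by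
    intro s hs
    simp_rw [ENNReal.ofReal_mul (hcos s)]
    rw [lintegral_const_mul' _ _ ENNReal.ofReal_ne_top,
      lintegral_rpow_mul_exp_neg_mul (by linarith) hs, ← ENNReal.ofReal_mul (hcos s),
      ← ENNReal.ofReal_mul (hcos s), ← ENNReal.ofReal_mul (by positivity)]
    congr 1
    rw [add_comm k 1, show -(1 + k) = -1 - k by ring]
    field_simp
  rw [setLIntegral_congr_fun measurableSet_Ioi hexp, lintegral_const_mul' _ _ ENNReal.ofReal_ne_top,
    lintegral_lintegral_swap (Measurable.aemeasurable (by fun_prop)),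
    setLIntegral_congr_fun measurableSet_Ioi fun x hx =>
      lintegral_one_sub_cos_mul_rpow_mul_exp_neg k hx,
    lintegral_rpow_div_one_add_sq hk0 hk2, ← ENNReal.ofReal_mul (by positivity)]
  congr 1
  field_simp

theorem lintegral_one_sub_cos_const_mul_rpow {k : ℝ} (hk0 : 0 < k) (hk2 : k < 2) (c : ℝ) :
    ∫⁻ s in Ioi (0 : ℝ), ENNReal.ofReal ((1 - Real.cos (c * s)) * s ^ (-1 - k)) =
      ENNReal.ofReal (|c| ^ k) * ENNReal.ofReal
        (Real.Gamma (k / 2) * Real.Gamma (1 - k / 2) / (2 * Real.Gamma (1 + k))) := by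
  rcases eq_or_ne c 0 with rfl | hc
  · simp [Real.zero_rpow hk0.ne']
  have hc' : 0 < |c| := abs_pos.2 hc
  have hck : 0 < |c| ^ k := by positivity
  have himage : (fun s => |c| * s) '' Ioi (0 : ℝ) = Ioi 0 := by
    simp [image_mul_left_Ioi hc']
  have hderiv : ∀ x ∈ Ioi (0 : ℝ), HasDerivWithinAt (fun s => |c| * s) |c| (Ioi 0) x :=
    fun x _ => by simpa using ((hasDerivAt_id x).const_mul |c|).hasDerivWithinAt
  conv_rhs => rw [← lintegral_one_sub_cos_mul_rpow hk0 hk2, ← himage]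
  rw [lintegral_image_eq_lintegral_abs_deriv_mul measurableSet_Ioi hderiv
    (mul_right_injective₀ hc'.ne').injOn, ← lintegral_const_mul' _ _ ENNReal.ofReal_ne_top]
  refine setLIntegral_congr_fun measurableSet_Ioi fun s hs => ?_
  have hs' : 0 < s := hs
  have hcos : Real.cos (|c| * s) = Real.cos (c * s) := by
    rw [← Real.cos_abs (c * s), abs_mul, abs_of_pos hs']
  simp only [abs_abs]
  rw [← ENNReal.ofReal_mul (abs_nonneg c), ← ENNReal.ofReal_mul hck.le, hcos,
    Real.mul_rpow (abs_nonneg c) hs'.le, Real.rpow_sub hc', Real.rpow_neg_one]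
  congr 1
  field_simp

variable {V : Type*} [NormedAddCommGroup V] [InnerProductSpace ℝ V] [FiniteDimensional ℝ V]
  [MeasurableSpace V] [BorelSpace V]

open scoped FourierTransform

theorem lintegral_rpow_mul_lintegral_sub_translate {f : V → ℂ} (hf : Integrable f)
    (hf2 : MemLp f 2) (e : V) {k : ℝ} (hk0 : 0 < k) (hk2 : k < 2) :
    ∫⁻ s in Ioi (0 : ℝ), ENNReal.ofReal (s ^ (-1 - k)) * ∫⁻ x, ‖f x - f (x + s • e)‖ₑ ^ 2 =
      ENNReal.ofReal ((2 * Real.pi) ^ k *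
          (Real.Gamma (k / 2) * Real.Gamma (1 - k / 2) / Real.Gamma (1 + k))) *
        ∫⁻ x, ENNReal.ofReal (|inner ℝ e x| ^ k) * ‖𝓕 f x‖ₑ ^ 2 := by
  have hmeas := (continuous_fourier hf).measurable
  have hcos : ∀ s ∈ Ioi (0 : ℝ), ENNReal.ofReal (s ^ (-1 - k)) *
      ∫⁻ x, ‖f x - f (x + s • e)‖ₑ ^ 2 =
        ∫⁻ x, ENNReal.ofReal 2 * ENNReal.ofReal ((1 - Real.cos (2 * Real.pi * inner ℝ e x * s)) *
          s ^ (-1 - k)) * ‖𝓕 f x‖ₑ ^ 2 := by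
    intro s hs
    rw [lintegral_enorm_sq_sub_translate hf hf2, ← lintegral_const_mul' _ _ ENNReal.ofReal_ne_top]
    refine lintegral_congr fun x => ?_
    rw [← mul_assoc, ← ENNReal.ofReal_mul (Real.rpow_nonneg (le_of_lt hs) _),
      ← ENNReal.ofReal_mul two_pos.le, real_inner_smul_left]
    ring_nf
  rw [setLIntegral_congr_fun measurableSet_Ioi hcos,
    lintegral_lintegral_swap (Measurable.aemeasurable (by fun_prop)),
    ← lintegral_const_mul' _ _ ENNReal.ofReal_ne_top]
  refine lintegral_congr fun x => ?_
  rw [lintegral_mul_const _ (by fun_prop), lintegral_const_mul' _ _ ENNReal.ofReal_ne_top,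
    lintegral_one_sub_cos_const_mul_rpow hk0 hk2, ← mul_assoc, ← mul_assoc,
    ← ENNReal.ofReal_mul (by positivity), ← ENNReal.ofReal_mul (by positivity),
    ← ENNReal.ofReal_mul' (by positivity), abs_mul, abs_of_pos Real.two_pi_pos,
    Real.mul_rpow Real.two_pi_pos.le (abs_nonneg _)]
  congr 2
  field_simp

end FractionalDifferences

section BallTransform

open Metric
open scoped FourierTransform

variable {V W : Type*} [NormedAddCommGroup V] [InnerProductSpace ℝ V] [FiniteDimensional ℝ V]
  [MeasurableSpace V] [BorelSpace V] [NormedAddCommGroup W] [InnerProductSpace ℝ W]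
  [FiniteDimensional ℝ W] [MeasurableSpace W] [BorelSpace W]

/-- The Fourier transform of the indicator function of the centred closed ball of radius `R`; the
kernels `ballKernel d` are its translates. -/
noncomputable def ballTransform (R : ℝ) : V → ℂ :=
  𝓕 ((closedBall (0 : V) R).indicator fun _ => (1 : ℂ))

theorem integrable_indicator_closedBall (R : ℝ) :
    Integrable ((closedBall (0 : V) R).indicator fun _ => (1 : ℂ)) :=
  (integrable_indicator_iff measurableSet_closedBall).2
    (integrableOn_const measure_closedBall_lt_top.ne)

theorem memLp_two_indicator_closedBall (R : ℝ) :
    MemLp ((closedBall (0 : V) R).indicator fun _ => (1 : ℂ)) 2 :=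
  memLp_indicator_const 2 measurableSet_closedBall 1 (Or.inr measure_closedBall_lt_top.ne)

theorem continuous_ballTransform (R : ℝ) : Continuous (ballTransform R : V → ℂ) :=
  continuous_fourier (integrable_indicator_closedBall R)

theorem lintegral_enorm_sq_ballTransform (R : ℝ) :
    ∫⁻ x : V, ‖ballTransform R x‖ₑ ^ 2 = volume (closedBall (0 : V) R) := by
  rw [← lintegral_indicator_one measurableSet_closedBall]
  refine (lintegral_enorm_sq_fourier (integrable_indicator_closedBall R)
    (memLp_two_indicator_closedBall R)).trans (lintegral_congr fun x => ?_)
  by_cases hx : x ∈ closedBall (0 : V) R <;> simp [hx]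

theorem ballTransform_eq_setIntegral (R : ℝ) (x : V) :
    ballTransform R x = ∫ y in closedBall (0 : V) R,
      Complex.exp (2 * (Real.pi : ℂ) * Complex.I * ((inner ℝ (-x) y : ℝ) : ℂ)) := by
  rw [ballTransform, Real.fourier_eq', ← integral_indicator measurableSet_closedBall]
  refine integral_congr_ae (Filter.Eventually.of_forall fun y => ?_)
  by_cases hy : y ∈ closedBall (0 : V) R
  · simp only [hy, Set.indicator_of_mem, smul_eq_mul, mul_one]
    congr 1
    rw [inner_neg_left, real_inner_comm]
    push_cast
    ring
  · simp only [hy, not_false_eq_true, Set.indicator_of_notMem, smul_zero]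

theorem ballTransform_zero (R : ℝ) :
    ballTransform R (0 : V) = ((volume.real (closedBall (0 : V) R) : ℝ) : ℂ) := by
  rw [ballTransform_eq_setIntegral]
  simp [Measure.real]

theorem norm_ballTransform_le (R : ℝ) (x : V) :
    ‖ballTransform R x‖ ≤ volume.real (closedBall (0 : V) R) := by
  rw [ballTransform_eq_setIntegral, ← one_mul (volume.real _)]
  refine norm_setIntegral_le_of_norm_le_const measure_closedBall_lt_top fun y _ => ?_
  rw [Complex.norm_exp]
  simp

theorem ballTransform_map (φ : V ≃ₗᵢ[ℝ] W) (R : ℝ) (x : V) :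
    ballTransform R (φ x) = ballTransform R x := by
  have hball : ((closedBall (0 : W) R).indicator fun _ => (1 : ℂ)) ∘ φ =
      (closedBall (0 : V) R).indicator fun _ => 1 := by
    funext y
    simp [Set.indicator]
  rw [ballTransform, ← Real.fourier_comp_linearIsometry φ, hball, ballTransform]

theorem ballTransform_eq_of_norm_eq (R : ℝ) {x y : V} (h : ‖x‖ = ‖y‖) :
    ballTransform R x = ballTransform R y := by
  rw [← Submodule.reflection_sub h, ballTransform_map]

end BallTransform

section BallKernel

open Metric

/-- The radius of the ball of volume `1 / π` in `ℝᵈ`. -/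
noncomputable def ballRadius (d : ℕ) : ℝ :=
  ((d : ℝ) * Real.Gamma ((d : ℝ) / 2) / (2 * Real.pi ^ (1 + (d : ℝ) / 2))) ^ ((d : ℝ)⁻¹)

theorem ballRadius_pow {d : ℕ} (hd : 1 ≤ d) :
    ballRadius d ^ d = d * Real.Gamma ((d : ℝ) / 2) / (2 * Real.pi ^ (1 + (d : ℝ) / 2)) := by
  have : 0 < Real.Gamma ((d : ℝ) / 2) := Real.Gamma_pos_of_pos (by positivity)
  exact Real.rpow_inv_natCast_pow (by positivity) (by positivity)

theorem ballRadius_nonneg {d : ℕ} (hd : 1 ≤ d) : 0 ≤ ballRadius d := by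
  have : 0 < Real.Gamma ((d : ℝ) / 2) := Real.Gamma_pos_of_pos (by positivity)
  rw [ballRadius]
  positivity

theorem ballRadius_two : ballRadius 2 = Real.pi⁻¹ := by
  refine (pow_left_inj₀ (ballRadius_nonneg one_le_two) (by positivity) two_ne_zero).1 ?_
  rw [ballRadius_pow one_le_two]
  norm_num
  field_simp

theorem setOf_norm_pow_le_eq_closedBall {d : ℕ} (hd : 1 ≤ d) :
    {y : EuclideanSpace ℝ (Fin d) |
        ‖y‖ ^ d ≤ (d : ℝ) * Real.Gamma ((d : ℝ) / 2) / (2 * Real.pi ^ (1 + (d : ℝ) / 2))} =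
      closedBall 0 (ballRadius d) := by
  ext y
  rw [Set.mem_ofPred_eq, mem_closedBall_zero_iff, ← ballRadius_pow hd]
  exact pow_le_pow_iff_left₀ (norm_nonneg _) (ballRadius_nonneg hd) (by positivity)

theorem volume_closedBall_ballRadius {d : ℕ} (hd : 1 ≤ d) :
    volume (closedBall (0 : EuclideanSpace ℝ (Fin d)) (ballRadius d)) =
      ENNReal.ofReal (1 / Real.pi) := by
  have : 0 < Real.Gamma ((d : ℝ) / 2) := Real.Gamma_pos_of_pos (by positivity)
  have : Nonempty (Fin d) := ⟨⟨0, hd⟩⟩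
  have hsqrt : Real.sqrt Real.pi ^ d = Real.pi ^ ((d : ℝ) / 2) := by
    rw [Real.sqrt_eq_rpow, ← Real.rpow_natCast, ← Real.rpow_mul Real.pi_pos.le]
    ring_nf
  rw [EuclideanSpace.volume_closedBall, ← ENNReal.ofReal_pow (ballRadius_nonneg hd),
    Fintype.card_fin, ballRadius_pow hd, ← ENNReal.ofReal_mul (by positivity),
    Real.Gamma_add_one (by positivity), hsqrt, Real.rpow_add Real.pi_pos, Real.rpow_one]
  congr 1
  field_simp

theorem ballKernel_eq_ballTransform {d : ℕ} (hd : 1 ≤ d) (v w : EuclideanSpace ℝ (Fin d)) :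
    ballKernel d v w = ballTransform (ballRadius d) (v - w) := by
  rw [ballTransform_eq_of_norm_eq _ (norm_sub_rev v w), ballTransform_eq_setIntegral, ballKernel,
    setOf_norm_pow_le_eq_closedBall hd, neg_sub]

theorem ballKernel_self {d : ℕ} (hd : 1 ≤ d) (u : EuclideanSpace ℝ (Fin d)) :
    ballKernel d u u = ((1 / Real.pi : ℝ) : ℂ) := by
  rw [ballKernel_eq_ballTransform hd, sub_self, ballTransform_zero, Measure.real,
    volume_closedBall_ballRadius hd, ENNReal.toReal_ofReal (by positivity)]

theorem ballDensity_eq_ballTransform {d : ℕ} (hd : 1 ≤ d) (u v : EuclideanSpace ℝ (Fin d)) :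
    ballDensity d u v = Real.pi * ‖ballTransform (ballRadius d) (v - u)‖ ^ 2 := by
  rw [ballDensity, ballKernel_eq_ballTransform hd, ballTransform_eq_of_norm_eq _ (norm_sub_rev u v)]

theorem ballDensity_self {d : ℕ} (hd : 1 ≤ d) (u : EuclideanSpace ℝ (Fin d)) :
    ballDensity d u u = 1 / Real.pi := by
  rw [ballDensity, ballKernel_self hd, Complex.norm_real, Real.norm_eq_abs, sq_abs]
  field_simp

theorem pushedOutIntensity_ballKernel {d : ℕ} (hd : 1 ≤ d) (u v : EuclideanSpace ℝ (Fin d)) :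
    pushedOutIntensity (ballKernel d) u v = ballDensity d u v := by
  rw [pushedOutIntensity, ballKernel_self hd, ballKernel_eq_ballTransform hd,
    ballDensity_eq_ballTransform hd, Complex.ofReal_re]
  field_simp

theorem ballDensity_nonneg (d : ℕ) (u v : EuclideanSpace ℝ (Fin d)) : 0 ≤ ballDensity d u v :=
  mul_nonneg Real.pi_pos.le (sq_nonneg _)

theorem measurable_ballDensity {d : ℕ} (hd : 1 ≤ d) (u : EuclideanSpace ℝ (Fin d)) :
    Measurable (ballDensity d u) := by
  have hmeas := (continuous_ballTransform (V := EuclideanSpace ℝ (Fin d)) (ballRadius d)).measurable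
  rw [funext (ballDensity_eq_ballTransform hd u)]
  fun_prop

theorem ofReal_ballDensity {d : ℕ} (hd : 1 ≤ d) (u v : EuclideanSpace ℝ (Fin d)) :
    ENNReal.ofReal (ballDensity d u v) =
      ENNReal.ofReal Real.pi * ‖ballTransform (ballRadius d) (v - u)‖ₑ ^ 2 := by
  rw [ballDensity_eq_ballTransform hd, ENNReal.ofReal_mul Real.pi_pos.le,
    ENNReal.ofReal_pow (norm_nonneg _), ofReal_norm]

theorem lintegral_ballDensity {d : ℕ} (hd : 1 ≤ d) (u : EuclideanSpace ℝ (Fin d)) :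
    ∫⁻ v, ENNReal.ofReal (ballDensity d u v) = 1 := by
  simp_rw [ofReal_ballDensity hd]
  rw [lintegral_const_mul' _ _ ENNReal.ofReal_ne_top,
    lintegral_sub_right_eq_self (fun v => ‖ballTransform (ballRadius d) v‖ₑ ^ 2) u,
    lintegral_enorm_sq_ballTransform, volume_closedBall_ballRadius hd,
    ← ENNReal.ofReal_mul Real.pi_pos.le, mul_one_div_cancel Real.pi_ne_zero, ENNReal.ofReal_one]

theorem isProbabilityDensity_ballDensity {d : ℕ} (hd : 1 ≤ d) (u : EuclideanSpace ℝ (Fin d)) :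
    IsProbabilityDensity (ballDensity d u) := by
  have hmeas := measurable_ballDensity hd u
  have hnonneg : ∀ᵐ v, 0 ≤ ballDensity d u v := .of_forall (ballDensity_nonneg d u)
  refine ⟨hmeas, ballDensity_nonneg d u, ?_, ?_⟩
  · rw [← lintegral_ofReal_ne_top_iff_integrable hmeas.aestronglyMeasurable hnonneg,
      lintegral_ballDensity hd]
    exact ENNReal.one_ne_top
  · rw [integral_eq_lintegral_of_nonneg_ae hnonneg hmeas.aestronglyMeasurable,
      lintegral_ballDensity hd, ENNReal.toReal_one]

theorem isGloballyMostRepulsive_ballKernel {d : ℕ} (hd : 1 ≤ d) :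
    IsGloballyMostRepulsive (ballKernel d) := by
  intro u _
  simp_rw [pushedOutIntensity_ballKernel hd]
  exact (isProbabilityDensity_ballDensity hd u).2.2.2

end BallKernel

section Bessel

open Metric Set

theorem integral_cos_pow_neg_pi_pi_add_two (n : ℕ) :
    ∫ θ in (-Real.pi)..Real.pi, Real.cos θ ^ (n + 2) =
      (n + 1) / (n + 2) * ∫ θ in (-Real.pi)..Real.pi, Real.cos θ ^ n := by
  rw [integral_cos_pow]
  simp

theorem integral_cos_pow_neg_pi_pi_odd (m : ℕ) :
    ∫ θ in (-Real.pi)..Real.pi, Real.cos θ ^ (2 * m + 1) = 0 := by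
  induction m with
  | zero => simp
  | succ m ih =>
    rw [show 2 * (m + 1) + 1 = (2 * m + 1) + 2 by ring, integral_cos_pow_neg_pi_pi_add_two, ih,
      mul_zero]

theorem integral_cos_pow_neg_pi_pi_even (m : ℕ) :
    ∫ θ in (-Real.pi)..Real.pi, Real.cos θ ^ (2 * m) =
      2 * Real.pi * (2 * m).factorial / (4 ^ m * (m.factorial : ℝ) ^ 2) := by
  induction m with
  | zero => simp; ring
  | succ m ih =>
    rw [show 2 * (m + 1) = 2 * m + 2 by ring, integral_cos_pow_neg_pi_pi_add_two, ih,
      Nat.factorial_succ, Nat.factorial_succ, Nat.factorial_succ]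
    push_cast
    field_simp
    ring

theorem integral_radial_mul_re_pow (f : ℝ → ℝ) (n : ℕ) :
    ∫ z : ℂ, f ‖z‖ * z.re ^ n =
      (∫ r in Ioi (0 : ℝ), r ^ (n + 1) * f r) *
        ∫ θ in (-Real.pi)..Real.pi, Real.cos θ ^ n := by
  have hpolar : ∀ p ∈ polarCoord.target, p.1 • (f ‖Complex.polarCoord.symm p‖ *
      (Complex.polarCoord.symm p).re ^ n) = p.1 ^ (n + 1) * f p.1 * Real.cos p.2 ^ n := by
    rintro ⟨r, θ⟩ ⟨hr, -⟩
    have hre : (Complex.polarCoord.symm (r, θ)).re = r * Real.cos θ := by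
      simp [-Complex.ofReal_cos]
    rw [Complex.norm_polarCoord_symm, abs_of_pos hr, hre, smul_eq_mul]
    ring
  rw [← Complex.integral_comp_polarCoord_symm,
    setIntegral_congr_fun polarCoord.open_target.measurableSet hpolar, polarCoord_target,
    Measure.volume_eq_prod, setIntegral_prod_mul (μ := volume) (ν := volume)
      (fun r : ℝ => r ^ (n + 1) * f r) (fun θ => Real.cos θ ^ n),
    ← integral_Ioc_eq_integral_Ioo, ← intervalIntegral.integral_of_le (by linarith [Real.pi_pos])]

theorem setIntegral_closedBall_re_pow {R : ℝ} (hR : 0 ≤ R) (n : ℕ) :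
    ∫ z in closedBall (0 : ℂ) R, z.re ^ n =
      R ^ (n + 2) / (n + 2) * ∫ θ in (-Real.pi)..Real.pi, Real.cos θ ^ n := by
  have hradial : ∀ z : ℂ, (closedBall (0 : ℂ) R).indicator (fun z => z.re ^ n) z =
      (Iic R).indicator 1 ‖z‖ * z.re ^ n := fun z => by
    by_cases hz : ‖z‖ ≤ R <;> simp [hz]
  have hIic : ∀ r : ℝ, r ^ (n + 1) * (Iic R).indicator 1 r =
      (Iic R).indicator (fun r => r ^ (n + 1)) r := fun r => by
    by_cases hr : r ≤ R <;> simp [hr]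
  rw [← integral_indicator measurableSet_closedBall, integral_congr_ae (.of_forall hradial),
    integral_radial_mul_re_pow, integral_congr_ae (.of_forall hIic),
    setIntegral_indicator measurableSet_Iic, Ioi_inter_Iic, ← intervalIntegral.integral_of_le hR,
    integral_pow]
  push_cast
  ring_nf

theorem ballTransform_ofReal (R t : ℝ) :
    ballTransform R (t : ℂ) = ∫ z in closedBall (0 : ℂ) R,
      Complex.exp (2 * (Real.pi : ℂ) * Complex.I * ((t * z.re : ℝ) : ℂ)) := by
  rw [ballTransform_eq_of_norm_eq R (norm_neg (t : ℂ)).symm, ballTransform_eq_setIntegral]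
  simp [Complex.inner, mul_comm]

theorem hasSum_ballTransform_ofReal (R t : ℝ) :
    HasSum (fun n : ℕ => ((2 * (Real.pi : ℂ) * Complex.I * t) ^ n / n.factorial) *
      ((∫ z in closedBall (0 : ℂ) R, z.re ^ n : ℝ) : ℂ)) (ballTransform R (t : ℂ)) := by
  have hexp : ∀ z : ℂ, HasSum
      (fun n : ℕ => (2 * (Real.pi : ℂ) * Complex.I * ((t * z.re : ℝ) : ℂ)) ^ n / n.factorial)
      (Complex.exp (2 * (Real.pi : ℂ) * Complex.I * ((t * z.re : ℝ) : ℂ))) := fun z => by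
    rw [Complex.exp_eq_exp_ℂ]
    exact NormedSpace.expSeries_div_hasSum_exp _
  have hbound : ∀ (n : ℕ), ∀ z ∈ closedBall (0 : ℂ) R,
      ‖(2 * (Real.pi : ℂ) * Complex.I * ((t * z.re : ℝ) : ℂ)) ^ n / n.factorial‖ ≤
        (2 * Real.pi * (|t| * R)) ^ n / n.factorial := by
    intro n z hz
    have hre : |z.re| ≤ R := (Complex.abs_re_le_norm z).trans (mem_closedBall_zero_iff.1 hz)
    rw [norm_div, norm_pow, Complex.norm_natCast]
    simp only [norm_mul, Complex.norm_ofNat, Complex.norm_real, Complex.norm_I, mul_one,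
      Real.norm_eq_abs, abs_of_pos Real.pi_pos]
    gcongr
  have hseries := hasSum_integral_of_dominated_convergence
    (μ := volume.restrict (closedBall (0 : ℂ) R))
    (F := fun (n : ℕ) (z : ℂ) =>
      (2 * (Real.pi : ℂ) * Complex.I * ((t * z.re : ℝ) : ℂ)) ^ n / (n.factorial : ℂ))
    (fun n _ => (2 * Real.pi * (|t| * R)) ^ n / n.factorial)
    (fun n => Continuous.aestronglyMeasurable (by fun_prop))
    (fun n => (ae_restrict_mem measurableSet_closedBall).mono (hbound n))
    (.of_forall fun _ => Real.summable_pow_div_factorial _)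
    (integrableOn_const measure_closedBall_lt_top.ne) (.of_forall hexp)
  rw [ballTransform_ofReal]
  refine hseries.congr_fun fun n => ?_
  rw [← integral_complex_ofReal, ← integral_const_mul]
  congr 1
  ext z
  push_cast
  ring

theorem besselJ_one_div_series_term {R t : ℝ} (hR : 0 ≤ R) (ht : t ≠ 0) (m : ℕ) :
    (2 * (Real.pi : ℂ) * Complex.I * t) ^ (2 * m) / (2 * m).factorial *
        ((∫ z in closedBall (0 : ℂ) R, z.re ^ (2 * m) : ℝ) : ℂ) =
      (((-1 : ℝ) ^ m / ((m.factorial : ℝ) * ((m + 1).factorial : ℝ)) *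
        (2 * Real.pi * R * t / 2) ^ (2 * m + 1) * (R / t) : ℝ) : ℂ) := by
  have hpow : (2 * (Real.pi : ℂ) * Complex.I * t) ^ (2 * m) =
      (((-1) ^ m * (2 * Real.pi * t) ^ (2 * m) : ℝ) : ℂ) := by
    rw [mul_right_comm, mul_pow, pow_mul Complex.I, Complex.I_sq]
    push_cast
    ring
  rw [setIntegral_closedBall_re_pow hR, integral_cos_pow_neg_pi_pi_even, hpow, Nat.factorial_succ m,
    ← Complex.ofReal_natCast, ← Complex.ofReal_div, ← Complex.ofReal_mul]
  congr 1
  rw [show (4 : ℝ) ^ m = 2 ^ (2 * m) by rw [pow_mul]; norm_num]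
  push_cast
  simp only [mul_pow, div_pow]
  field_simp
  ring

theorem ballTransform_ofReal_eq_besselJ {R t : ℝ} (hR : 0 ≤ R) (ht : t ≠ 0) :
    ballTransform R (t : ℂ) = ((besselJ 1 (2 * Real.pi * R * t) * (R / t) : ℝ) : ℂ) := by
  have hodd : ∀ n : ℕ, n ∉ range (fun m : ℕ => 2 * m) →
      ((2 * (Real.pi : ℂ) * Complex.I * t) ^ n / n.factorial) *
        ((∫ z in closedBall (0 : ℂ) R, z.re ^ n : ℝ) : ℂ) = 0 := by
    intro n hn
    obtain ⟨m, rfl | rfl⟩ := n.even_or_odd'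
    · exact absurd ⟨m, rfl⟩ hn
    · rw [setIntegral_closedBall_re_pow hR, integral_cos_pow_neg_pi_pi_odd, mul_zero,
        Complex.ofReal_zero, mul_zero]
  have heven := ((mul_right_injective₀ (two_ne_zero : (2 : ℕ) ≠ 0)).hasSum_iff hodd).2
    (hasSum_ballTransform_ofReal R t)
  rw [← (heven.congr_fun fun m => (besselJ_one_div_series_term hR ht m).symm).tsum_eq,
    ← Complex.ofReal_tsum, tsum_mul_right, besselJ]

theorem ballDensity_two_of_ne {u v : EuclideanSpace ℝ (Fin 2)} (h : v ≠ u) :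
    ballDensity 2 u v = besselJ 1 (2 * ‖v - u‖) ^ 2 / (Real.pi * ‖v - u‖ ^ 2) := by
  have hnorm : ‖v - u‖ ≠ 0 := norm_ne_zero_iff.2 (sub_ne_zero.2 h)
  have hradial : ‖Complex.orthonormalBasisOneI.repr.symm (v - u)‖ = ‖((‖v - u‖ : ℝ) : ℂ)‖ := by
    rw [LinearIsometryEquiv.norm_map, Complex.norm_real, norm_norm]
  have harg : 2 * Real.pi * Real.pi⁻¹ * ‖v - u‖ = 2 * ‖v - u‖ := by
    field_simp
  rw [ballDensity_eq_ballTransform one_le_two, ballRadius_two,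
    ← ballTransform_map Complex.orthonormalBasisOneI.repr.symm,
    ballTransform_eq_of_norm_eq _ hradial,
    ballTransform_ofReal_eq_besselJ (by positivity) hnorm, harg, Complex.norm_real,
    Real.norm_eq_abs, sq_abs]
  field_simp

end Bessel

section PolarMoments

open Set
open scoped ENNReal

/-- The absolute moment of order `a` of the cosine over a full period, the factor by which a radial
integral over the plane changes when it is weighted by `|cos θ| ^ a`. -/
noncomputable def absCosMoment (a : ℝ) : ℝ≥0∞ :=
  ∫⁻ θ in Ioo (-Real.pi) Real.pi, ENNReal.ofReal (|Real.cos θ| ^ a)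

theorem lintegral_radial_mul_abs_re_rpow {F : ℝ → ℝ≥0∞} (hF : Measurable F) (a : ℝ) :
    ∫⁻ z : ℂ, F ‖z‖ * ENNReal.ofReal (|z.re| ^ a) =
      (∫⁻ r in Ioi (0 : ℝ), ENNReal.ofReal (r ^ (1 + a)) * F r) * absCosMoment a := by
  rw [← Complex.lintegral_comp_polarCoord_symm]
  have hseparated : ∀ p ∈ polarCoord.target, ENNReal.ofReal p.1 •
      (F ‖Complex.polarCoord.symm p‖ *
        ENNReal.ofReal (|(Complex.polarCoord.symm p).re| ^ a)) =
      (ENNReal.ofReal (p.1 ^ (1 + a)) * F p.1) * ENNReal.ofReal (|Real.cos p.2| ^ a) := by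
    rintro ⟨r, θ⟩ ⟨hr : 0 < r, -⟩
    have hre : (Complex.polarCoord.symm (r, θ)).re = r * Real.cos θ := by
      simp [-Complex.ofReal_cos]
    rw [Complex.norm_polarCoord_symm, abs_of_pos hr, hre, abs_mul, abs_of_pos hr,
      Real.mul_rpow hr.le (abs_nonneg _), ENNReal.ofReal_mul (by positivity),
      Real.rpow_add hr, Real.rpow_one, ENNReal.ofReal_mul hr.le, smul_eq_mul]
    ring
  rw [setLIntegral_congr_fun polarCoord.open_target.measurableSet hseparated, polarCoord_target,
    Measure.volume_eq_prod, ← Measure.prod_restrict,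
    lintegral_prod_mul (f := fun r => ENNReal.ofReal (r ^ (1 + a)) * F r)
      (g := fun θ => ENNReal.ofReal (|Real.cos θ| ^ a)) (Measurable.aemeasurable (by fun_prop))
      (Measurable.aemeasurable (by fun_prop)), absCosMoment]

theorem absCosMoment_zero : absCosMoment 0 = ENNReal.ofReal (2 * Real.pi) := by
  simp [absCosMoment, two_mul]

theorem lintegral_radial_mul_norm_rpow {F : ℝ → ℝ≥0∞} (hF : Measurable F) (a : ℝ) :
    ∫⁻ z : ℂ, F ‖z‖ * ENNReal.ofReal (‖z‖ ^ a) =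
      (∫⁻ r in Ioi (0 : ℝ), ENNReal.ofReal (r ^ (1 + a)) * F r) * ENNReal.ofReal (2 * Real.pi) := by
  have habsorb : ∀ r ∈ Ioi (0 : ℝ), ENNReal.ofReal r * (F r * ENNReal.ofReal (r ^ a)) =
      ENNReal.ofReal (r ^ (1 + a)) * F r := by
    intro r (hr : 0 < r)
    rw [Real.rpow_add hr, Real.rpow_one, ENNReal.ofReal_mul hr.le]
    ring
  have h := lintegral_radial_mul_abs_re_rpow
    (F := fun r => F r * ENNReal.ofReal (r ^ a)) (by fun_prop) 0
  simp only [Real.rpow_zero, ENNReal.ofReal_one, mul_one, add_zero, Real.rpow_one] at h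
  rw [h, absCosMoment_zero, setLIntegral_congr_fun measurableSet_Ioi habsorb]

theorem two_pi_mul_lintegral_radial_mul_abs_re_rpow {F : ℝ → ℝ≥0∞} (hF : Measurable F) (a : ℝ) :
    ENNReal.ofReal (2 * Real.pi) * ∫⁻ z : ℂ, F ‖z‖ * ENNReal.ofReal (|z.re| ^ a) =
      absCosMoment a * ∫⁻ z : ℂ, F ‖z‖ * ENNReal.ofReal (‖z‖ ^ a) := by
  rw [lintegral_radial_mul_abs_re_rpow hF, lintegral_radial_mul_norm_rpow hF]
  ring

theorem lintegral_comp_abs (f : ℝ → ℝ≥0∞) :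
    ∫⁻ x : ℝ, f |x| = 2 * ∫⁻ x in Ioi (0 : ℝ), f x := by
  have hpos : ∫⁻ x in Ioi (0 : ℝ), f |x| = ∫⁻ x in Ioi (0 : ℝ), f x :=
    setLIntegral_congr_fun measurableSet_Ioi fun x hx => by rw [abs_of_pos hx]
  have hneg : ∫⁻ x in Iic (0 : ℝ), f |x| = ∫⁻ x in Ioi (0 : ℝ), f x := by
    rw [setLIntegral_congr Iio_ae_eq_Iic.symm, ← hpos,
      ← (Measure.measurePreserving_neg (volume : Measure ℝ)).setLIntegral_comp_preimage_emb
        (MeasurableEquiv.neg ℝ).measurableEmbedding]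
    simp
  rw [← lintegral_add_compl _ (measurableSet_Ioi (a := (0 : ℝ))), compl_Ioi, hpos, hneg, two_mul]

theorem lintegral_complex_eq {f : ℂ → ℝ≥0∞} (hf : Measurable f) :
    ∫⁻ z, f z = ∫⁻ y : ℝ, ∫⁻ x : ℝ, f ⟨x, y⟩ := by
  rw [← Complex.volume_preserving_equiv_real_prod.symm.lintegral_comp hf, Measure.volume_eq_prod,
    lintegral_prod_symm' (fun p => f (Complex.measurableEquivRealProd.symm p))
      (hf.comp Complex.measurableEquivRealProd.symm.measurable)]
  rfl

theorem lintegral_rpow_mul_exp_neg_sq {q : ℝ} (hq : -1 < q) :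
    ∫⁻ x in Ioi (0 : ℝ), ENNReal.ofReal (x ^ q * Real.exp (-x ^ 2)) =
      ENNReal.ofReal (Real.Gamma ((q + 1) / 2) / 2) := by
  have h := lintegral_rpow_mul_exp_neg_mul_rpow two_pos hq one_pos
  simp only [Real.one_rpow, neg_one_mul, Real.rpow_two] at h
  rw [h]
  congr 1
  ring

theorem lintegral_exp_neg_sq :
    ∫⁻ y : ℝ, ENNReal.ofReal (Real.exp (-y ^ 2)) = ENNReal.ofReal (Real.sqrt Real.pi) := by
  have hint := integrable_exp_neg_mul_sq one_pos
  have hval := integral_gaussian 1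
  simp only [neg_one_mul, div_one] at hint hval
  rw [← ofReal_integral_eq_lintegral_ofReal hint (.of_forall fun _ => (Real.exp_pos _).le), hval]

theorem lintegral_exp_neg_sq_mul_abs_re_rpow (a : ℝ) :
    ∫⁻ z : ℂ, ENNReal.ofReal (Real.exp (-‖z‖ ^ 2)) * ENNReal.ofReal (|z.re| ^ a) =
      ENNReal.ofReal (Real.sqrt Real.pi) *
        (2 * ∫⁻ x in Ioi (0 : ℝ), ENNReal.ofReal (x ^ a * Real.exp (-x ^ 2))) := by
  have hseparated : ∀ x y : ℝ, ENNReal.ofReal (Real.exp (-‖(⟨x, y⟩ : ℂ)‖ ^ 2)) *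
      ENNReal.ofReal (|x| ^ a) = ENNReal.ofReal (Real.exp (-y ^ 2)) *
        ENNReal.ofReal (|x| ^ a * Real.exp (-|x| ^ 2)) := by
    intro x y
    rw [← ENNReal.ofReal_mul (by positivity), ← ENNReal.ofReal_mul (by positivity),
      Complex.sq_norm, Complex.normSq_mk, mul_left_comm, ← Real.exp_add, sq_abs, mul_comm]
    congr 3
    ring
  rw [lintegral_complex_eq (by fun_prop)]
  simp_rw [hseparated, lintegral_const_mul' _ _ ENNReal.ofReal_ne_top]
  rw [lintegral_mul_const _ (by fun_prop), lintegral_exp_neg_sq,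
    lintegral_comp_abs fun x => ENNReal.ofReal (x ^ a * Real.exp (-x ^ 2))]

-- Both sides are the integral of `exp (-‖z‖ ^ 2) * |z.re| ^ a`, in polar and Cartesian coordinates.
theorem ofReal_Gamma_mul_absCosMoment {a : ℝ} (ha : -2 < a) :
    ENNReal.ofReal (Real.Gamma (a / 2 + 1) / 2) * absCosMoment a =
      ENNReal.ofReal (Real.sqrt Real.pi) *
        (2 * ∫⁻ x in Ioi (0 : ℝ), ENNReal.ofReal (x ^ a * Real.exp (-x ^ 2))) := by
  rw [← lintegral_exp_neg_sq_mul_abs_re_rpow, lintegral_radial_mul_abs_re_rpow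
    (F := fun r => ENNReal.ofReal (Real.exp (-r ^ 2))) (by fun_prop),
    show a / 2 + 1 = (1 + a + 1) / 2 by ring, ← lintegral_rpow_mul_exp_neg_sq (by linarith)]
  congr 1
  refine setLIntegral_congr_fun measurableSet_Ioi fun r (hr : 0 < r) => ?_
  rw [ENNReal.ofReal_mul (by positivity)]

theorem absCosMoment_eq {a : ℝ} (ha : -1 < a) :
    absCosMoment a = ENNReal.ofReal
      (2 * Real.pi * 2 ^ (-a) * Real.Gamma (1 + a) / Real.Gamma (1 + a / 2) ^ 2) := by
  have hG : 0 < Real.Gamma (1 + a / 2) := Real.Gamma_pos_of_pos (by linarith)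
  have hG' : 0 < Real.Gamma (1 + a) := Real.Gamma_pos_of_pos (by linarith)
  have hne : ENNReal.ofReal (Real.Gamma (a / 2 + 1) / 2) ≠ 0 :=
    ENNReal.ofReal_ne_zero_iff.2 (by rw [add_comm]; positivity)
  have hduplication : Real.Gamma ((a + 1) / 2) * Real.Gamma (1 + a / 2) =
      Real.Gamma (1 + a) * 2 ^ (-a) * Real.sqrt Real.pi := by
    have h := Real.Gamma_mul_Gamma_add_half ((a + 1) / 2)
    rwa [show (a + 1) / 2 + 1 / 2 = 1 + a / 2 by ring, show 2 * ((a + 1) / 2) = 1 + a by ring,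
      show 1 - (1 + a) = -a by ring] at h
  rw [← ENNReal.mul_right_inj hne ENNReal.ofReal_ne_top,
    ofReal_Gamma_mul_absCosMoment (by linarith), lintegral_rpow_mul_exp_neg_sq ha,
    add_comm (a / 2), ← ENNReal.ofReal_ofNat, ← ENNReal.ofReal_mul two_pos.le,
    ← ENNReal.ofReal_mul (by positivity), ← ENNReal.ofReal_mul (by positivity),
    eq_div_of_mul_eq hG.ne' hduplication]
  congr 1
  generalize Real.Gamma (1 + a / 2) = G at hG
  field_simp
  exact Real.sq_sqrt Real.pi_pos.le

theorem lintegral_Ioo_rpow_neg_one : ∫⁻ x in Ioo (0 : ℝ) 1, ENNReal.ofReal (x ^ (-1 : ℝ)) = ⊤ := by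
  by_contra hne
  rw [← ne_eq, lintegral_ofReal_ne_top_iff_integrable
    (Measurable.aestronglyMeasurable (by fun_prop))] at hne
  · exact lt_irrefl _ ((intervalIntegral.integrableOn_Ioo_rpow_iff one_pos).1 hne)
  · filter_upwards [ae_restrict_mem measurableSet_Ioo] with x hx
    exact Real.rpow_nonneg hx.1.le _

theorem lintegral_rpow_neg_one_mul_exp_neg_sq :
    ∫⁻ x in Ioi (0 : ℝ), ENNReal.ofReal (x ^ (-1 : ℝ) * Real.exp (-x ^ 2)) = ⊤ := by
  rw [eq_top_iff]
  calc ⊤ = ∫⁻ x in Ioo (0 : ℝ) 1, ENNReal.ofReal (x ^ (-1 : ℝ)) *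
        ENNReal.ofReal (Real.exp (-1)) := by
        rw [lintegral_mul_const' _ _ ENNReal.ofReal_ne_top, lintegral_Ioo_rpow_neg_one,
          ENNReal.top_mul (ENNReal.ofReal_ne_zero_iff.2 (Real.exp_pos _))]
    _ ≤ ∫⁻ x in Ioo (0 : ℝ) 1, ENNReal.ofReal (x ^ (-1 : ℝ) * Real.exp (-x ^ 2)) := by
        refine setLIntegral_mono' measurableSet_Ioo fun x hx => ?_
        rw [← ENNReal.ofReal_mul (Real.rpow_nonneg hx.1.le _)]
        have := Real.rpow_nonneg hx.1.le (-1)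
        gcongr
        nlinarith [hx.1, hx.2]
    _ ≤ _ := lintegral_mono_set Ioo_subset_Ioi_self

theorem absCosMoment_neg_one : absCosMoment (-1) = ⊤ := by
  have h := ofReal_Gamma_mul_absCosMoment (a := -1) (by norm_num)
  rw [lintegral_rpow_neg_one_mul_exp_neg_sq, ENNReal.mul_top two_ne_zero,
    ENNReal.mul_top (ENNReal.ofReal_ne_zero_iff.2 (Real.sqrt_pos.2 Real.pi_pos))] at h
  by_contra hne
  exact ENNReal.mul_ne_top ENNReal.ofReal_ne_top hne h

end PolarMoments

section DiscTranslation

open Set Metric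
open scoped ENNReal symmDiff

theorem lintegral_enorm_sq_indicator_sub_translate {V : Type*} [AddGroup V] [MeasurableSpace V]
    [MeasurableAdd V] {μ : Measure V} [μ.IsAddRightInvariant] {s : Set V} (hs : MeasurableSet s)
    (hfin : μ s ≠ ⊤) (e : V) :
    ∫⁻ x, ‖s.indicator (fun _ => (1 : ℂ)) x - s.indicator (fun _ => (1 : ℂ)) (x + e)‖ₑ ^ 2 ∂μ =
      2 * μ {x | x ∈ s ∧ x + e ∉ s} := by
  set t : Set V := (· + e) ⁻¹' s
  have ht : MeasurableSet t := measurable_add_const e hs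
  have hst : μ s = μ t := (measure_preimage_add_right μ e s).symm
  have hpointwise : ∀ x, ‖s.indicator (fun _ => (1 : ℂ)) x -
      s.indicator (fun _ => (1 : ℂ)) (x + e)‖ₑ ^ 2 = (s ∆ t).indicator 1 x := by
    intro x
    have hxt : x ∈ t ↔ x + e ∈ s := Iff.rfl
    by_cases hx : x ∈ s <;> by_cases hy : x + e ∈ s <;> simp [indicator, mem_symmDiff, hx, hy, hxt]
  simp_rw [hpointwise]
  rw [lintegral_indicator_one (hs.symmDiff ht),
    measure_symmDiff_eq hs.nullMeasurableSet ht.nullMeasurableSet,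
    ← measure_sdiff_symm hs.nullMeasurableSet ht.nullMeasurableSet hst
      (measure_ne_top_of_subset inter_subset_left hfin), two_mul]
  rfl

theorem volume_Icc_inter_translate_notMem (a : ℝ) {s : ℝ} (hs : 0 < s) :
    volume {x | x ∈ Icc (-a) a ∧ x + s ∉ Icc (-a) a} =
      volume {x | x ∈ Icc (-a) a ∧ 2 * |x| < s} := by
  rcases le_or_gt s (2 * a) with h | h
  · have hleft : {x | x ∈ Icc (-a) a ∧ x + s ∉ Icc (-a) a} = Ioc (a - s) a := by
      ext x
      simp only [mem_Icc, mem_ofPred_eq, mem_Ioc]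
      grind
    have hright : {x | x ∈ Icc (-a) a ∧ 2 * |x| < s} = Ioo (-(s / 2)) (s / 2) := by
      ext x
      simp only [mem_Icc, mem_ofPred_eq, mem_Ioo]
      grind
    rw [hleft, hright, Real.volume_Ioc, Real.volume_Ioo]
    congr 1
    ring
  · congr 1
    ext x
    simp only [mem_Icc, mem_ofPred_eq]
    grind

theorem volume_complex_eq {s : Set ℂ} (hs : MeasurableSet s) :
    volume s = ∫⁻ y : ℝ, volume {x : ℝ | (⟨x, y⟩ : ℂ) ∈ s} := by
  rw [← lintegral_indicator_one hs, lintegral_complex_eq (measurable_one.indicator hs)]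
  refine lintegral_congr fun y => ?_
  have hmk : Measurable fun x : ℝ => (⟨x, y⟩ : ℂ) :=
    Complex.measurableEquivRealProd.symm.measurable.comp (measurable_id.prodMk measurable_const)
  exact lintegral_indicator_one (hmk hs)

theorem exists_setOf_mk_mem_closedBall_eq_Icc (R y : ℝ) :
    ∃ a : ℝ, {x : ℝ | (⟨x, y⟩ : ℂ) ∈ closedBall (0 : ℂ) R} = Icc (-a) a := by
  by_cases hy : |y| ≤ R
  · refine ⟨Real.sqrt (R ^ 2 - y ^ 2), Set.ext fun x => ?_⟩
    have hR : 0 ≤ R := (abs_nonneg y).trans hy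
    have hyR : y ^ 2 ≤ R ^ 2 := sq_le_sq.2 (hy.trans (le_abs_self R))
    rw [mem_ofPred_eq, mem_closedBall_zero_iff, mem_Icc, ← abs_le,
      Complex.norm_eq_sqrt_sq_add_sq, Real.sqrt_le_left hR,
      Real.le_sqrt (abs_nonneg x) (by linarith), sq_abs, le_sub_iff_add_le]
  · refine ⟨-1, ?_⟩
    rw [neg_neg, Icc_eq_empty (by norm_num), eq_empty_iff_forall_notMem]
    intro x hx
    exact hy ((Complex.abs_im_le_norm ⟨x, y⟩).trans (mem_closedBall_zero_iff.1 hx))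

theorem lintegral_enorm_sq_indicator_disc_sub_translate (R : ℝ) {s : ℝ} (hs : 0 < s) :
    ∫⁻ z, ‖(closedBall (0 : ℂ) R).indicator (fun _ => (1 : ℂ)) z -
        (closedBall (0 : ℂ) R).indicator (fun _ => (1 : ℂ)) (z + s)‖ₑ ^ 2 =
      2 * volume.restrict (closedBall (0 : ℂ) R) {z | 2 * |z.re| < s} := by
  have hball : MeasurableSet (closedBall (0 : ℂ) R) := measurableSet_closedBall
  have hstrip : MeasurableSet {z : ℂ | 2 * |z.re| < s} :=
    measurableSet_lt (by fun_prop) measurable_const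
  have hlens : MeasurableSet {z : ℂ | z ∈ closedBall 0 R ∧ z + s ∉ closedBall 0 R} :=
    hball.inter (measurable_add_const (s : ℂ) hball.compl)
  rw [lintegral_enorm_sq_indicator_sub_translate hball measure_closedBall_lt_top.ne,
    Measure.restrict_apply hstrip, inter_comm, volume_complex_eq hlens,
    volume_complex_eq (hball.inter hstrip)]
  congr 1
  refine lintegral_congr fun y => ?_
  obtain ⟨a, ha⟩ := exists_setOf_mk_mem_closedBall_eq_Icc R y
  have hslice : ∀ x : ℝ, (⟨x, y⟩ : ℂ) ∈ closedBall (0 : ℂ) R ↔ x ∈ Icc (-a) a :=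
    Set.ext_iff.1 ha
  have hshift : ∀ x : ℝ, (⟨x, y⟩ : ℂ) + s = ⟨x + s, y⟩ := fun x => by
    apply Complex.ext <;> simp
  simp only [mem_ofPred_eq, mem_inter_iff, hshift, hslice]
  exact volume_Icc_inter_translate_notMem a hs

theorem lintegral_Ioi_rpow_neg_one_sub {c k : ℝ} (hc : 0 < c) (hk : 0 < k) :
    ∫⁻ s in Ioi c, ENNReal.ofReal (s ^ (-1 - k)) = ENNReal.ofReal (c ^ (-k) / k) := by
  rw [← ofReal_integral_eq_lintegral_ofReal (integrableOn_Ioi_rpow_of_lt (by linarith) hc),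
    integral_Ioi_rpow_of_lt (by linarith) hc, show -1 - k + 1 = -k by ring, neg_div_neg_eq]
  filter_upwards [ae_restrict_mem measurableSet_Ioi] with x hx
  exact Real.rpow_nonneg (hc.trans hx).le _

theorem lintegral_rpow_mul_measure_lt {α : Type*} [MeasurableSpace α] {μ : Measure α} [SFinite μ]
    {g : α → ℝ} (hg : Measurable g) (hpos : ∀ᵐ x ∂μ, 0 < g x) {k : ℝ} (hk : 0 < k) :
    ∫⁻ s in Ioi (0 : ℝ), ENNReal.ofReal (s ^ (-1 - k)) * μ {x | g x < s} =
      ∫⁻ x, ENNReal.ofReal (g x ^ (-k) / k) ∂μ := by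
  have hmeas : Measurable ({p : ℝ × α | g p.2 < p.1}.indicator
      fun p => ENNReal.ofReal (p.1 ^ (-1 - k))) :=
    Measurable.indicator (by fun_prop) (measurableSet_lt (by fun_prop) measurable_fst)
  have hlayer : ∀ s : ℝ, ENNReal.ofReal (s ^ (-1 - k)) * μ {x | g x < s} =
      ∫⁻ x, {p : ℝ × α | g p.2 < p.1}.indicator
        (fun p => ENNReal.ofReal (p.1 ^ (-1 - k))) (s, x) ∂μ := fun s =>
    (lintegral_indicator_const (measurableSet_lt hg measurable_const) _).symm
  simp_rw [hlayer]
  rw [lintegral_lintegral_swap]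
  · refine lintegral_congr_ae ?_
    filter_upwards [hpos] with x hx
    rw [← lintegral_Ioi_rpow_neg_one_sub hx hk, ← inter_eq_left.2 (Ioi_subset_Ioi hx.le),
      ← setLIntegral_indicator measurableSet_Ioi]
    rfl
  · exact hmeas.aemeasurable

theorem ae_re_ne_zero : ∀ᵐ z : ℂ, z.re ≠ 0 := by
  have hnull : volume {z : ℂ | z.re = 0} = 0 := by
    rw [volume_complex_eq (measurableSet_eq_fun (by fun_prop) measurable_const)]
    simp
  simpa [ae_iff] using hnull

theorem lintegral_rpow_mul_indicator_Iic {R p : ℝ} (hR : 0 ≤ R) (hp : -1 < p) :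
    ∫⁻ r in Ioi (0 : ℝ), ENNReal.ofReal (r ^ p) * (Iic R).indicator 1 r =
      ENNReal.ofReal (R ^ (p + 1) / (p + 1)) := by
  simp_rw [← indicator_mul_right (Iic R) fun r => ENNReal.ofReal (r ^ p), Pi.one_apply, mul_one]
  rw [setLIntegral_indicator measurableSet_Iic, inter_comm, Ioi_inter_Iic,
    ← ofReal_integral_eq_lintegral_ofReal, ← intervalIntegral.integral_of_le hR,
    integral_rpow (Or.inl hp), Real.zero_rpow (by linarith), sub_zero]
  · exact (intervalIntegrable_iff_integrableOn_Ioc_of_le hR).1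
      (intervalIntegral.intervalIntegrable_rpow' hp)
  · filter_upwards [ae_restrict_mem measurableSet_Ioc] with x hx
    exact Real.rpow_nonneg hx.1.le _

theorem setLIntegral_closedBall_eq_lintegral_mul (R : ℝ) (f : ℂ → ℝ≥0∞) :
    ∫⁻ z in closedBall 0 R, f z = ∫⁻ z, (Iic R).indicator 1 ‖z‖ * f z := by
  rw [← lintegral_indicator measurableSet_closedBall]
  refine lintegral_congr fun z => ?_
  by_cases hz : ‖z‖ ≤ R <;> simp [indicator, hz]

theorem setLIntegral_closedBall_abs_re_rpow {R a : ℝ} (hR : 0 ≤ R) (ha : -2 < a) :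
    ∫⁻ z in closedBall (0 : ℂ) R, ENNReal.ofReal (|z.re| ^ a) =
      ENNReal.ofReal (R ^ (2 + a) / (2 + a)) * absCosMoment a := by
  rw [setLIntegral_closedBall_eq_lintegral_mul,
    lintegral_radial_mul_abs_re_rpow (measurable_one.indicator measurableSet_Iic),
    lintegral_rpow_mul_indicator_Iic hR (by linarith), show 1 + a + 1 = 2 + a by ring]

theorem lintegral_rpow_mul_lintegral_disc_sub_translate {R k : ℝ} (hR : 0 ≤ R) (hk0 : 0 < k)
    (hk2 : k < 2) :
    ∫⁻ s in Ioi (0 : ℝ), ENNReal.ofReal (s ^ (-1 - k)) *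
      ∫⁻ z, ‖(closedBall (0 : ℂ) R).indicator (fun _ => (1 : ℂ)) z -
        (closedBall (0 : ℂ) R).indicator (fun _ => (1 : ℂ)) (z + s)‖ₑ ^ 2 =
      ENNReal.ofReal (2 ^ (1 - k) / k * (R ^ (2 - k) / (2 - k))) * absCosMoment (-k) := by
  have hpos : ∀ᵐ z ∂volume.restrict (closedBall (0 : ℂ) R), 0 < 2 * |z.re| := by
    filter_upwards [ae_restrict_of_ae ae_re_ne_zero] with z hz
    positivity
  have hscale : ∀ x : ℝ, 2 * ENNReal.ofReal ((2 * |x|) ^ (-k) / k) =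
      ENNReal.ofReal (2 ^ (1 - k) / k) * ENNReal.ofReal (|x| ^ (-k)) := by
    intro x
    rw [← ENNReal.ofReal_ofNat, ← ENNReal.ofReal_mul two_pos.le,
      ← ENNReal.ofReal_mul (by positivity), Real.mul_rpow two_pos.le (abs_nonneg x),
      sub_eq_add_neg, Real.rpow_add two_pos, Real.rpow_one]
    congr 1
    ring
  rw [setLIntegral_congr_fun measurableSet_Ioi fun s (hs : 0 < s) => by
    rw [lintegral_enorm_sq_indicator_disc_sub_translate R hs, mul_left_comm]]
  rw [lintegral_const_mul' _ _ ENNReal.ofNat_ne_top,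
    lintegral_rpow_mul_measure_lt (by fun_prop) hpos hk0,
    ← lintegral_const_mul' _ _ ENNReal.ofNat_ne_top]
  simp_rw [hscale]
  rw [lintegral_const_mul' _ _ ENNReal.ofReal_ne_top,
    setLIntegral_closedBall_abs_re_rpow hR (by linarith), ← sub_eq_add_neg, ← mul_assoc,
    ENNReal.ofReal_mul (by positivity)]

theorem lintegral_abs_re_rpow_mul_enorm_sq_ballTransform {R k : ℝ} (hR : 0 ≤ R) (hk0 : 0 < k)
    (hk2 : k < 2) :
    ENNReal.ofReal ((2 * Real.pi) ^ k *
        (Real.Gamma (k / 2) * Real.Gamma (1 - k / 2) / Real.Gamma (1 + k))) *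
      ∫⁻ z : ℂ, ENNReal.ofReal (|z.re| ^ k) * ‖ballTransform R z‖ₑ ^ 2 =
    ENNReal.ofReal (2 ^ (1 - k) / k * (R ^ (2 - k) / (2 - k))) * absCosMoment (-k) := by
  have hre : ∀ z : ℂ, inner ℝ 1 z = z.re := fun z => by simp [Complex.inner]
  have hsmul : ∀ s : ℝ, s • (1 : ℂ) = s := fun s => by simp
  have h := lintegral_rpow_mul_lintegral_sub_translate (integrable_indicator_closedBall R)
    (memLp_two_indicator_closedBall R) (1 : ℂ) hk0 hk2
  simp_rw [hre, hsmul] at h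
  exact h.symm.trans (lintegral_rpow_mul_lintegral_disc_sub_translate hR hk0 hk2)

end DiscTranslation

section DiscMoments

open Set Metric
open scoped ENNReal

/-- The closed form of the `k`-th moment of the distance between a point and the one it pushes out
in the planar case. -/
noncomputable def discMoment (k : ℝ) : ℝ :=
  Real.Gamma (1 + k / 2) * Real.Gamma (1 - k) /
    (Real.Gamma (2 - k / 2) * Real.Gamma (1 - k / 2) ^ 2)

theorem discMoment_pos {k : ℝ} (h1 : -2 < k) (h2 : k < 1) : 0 < discMoment k := by
  have := Real.Gamma_pos_of_pos (show 0 < 1 + k / 2 by linarith)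
  have := Real.Gamma_pos_of_pos (show 0 < 1 - k by linarith)
  have := Real.Gamma_pos_of_pos (show 0 < 2 - k / 2 by linarith)
  have := Real.Gamma_pos_of_pos (show 0 < 1 - k / 2 by linarith)
  rw [discMoment]
  positivity

theorem analyticAt_realGamma {x : ℝ} (hx : 0 < x) : AnalyticAt ℝ Real.Gamma x := by
  have h : AnalyticAt ℂ Complex.Gamma (x : ℂ) := by
    refine DifferentiableOn.analyticAt (s := {s : ℂ | 0 < s.re}) (fun s (hs : 0 < s.re) => ?_)
      ((isOpen_lt continuous_const Complex.continuous_re).mem_nhds (by simpa using hx))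
    refine (Complex.differentiableAt_Gamma s fun m hm => ?_).differentiableWithinAt
    rw [hm, Complex.neg_re, Complex.natCast_re] at hs
    linarith [(Nat.cast_nonneg m : (0 : ℝ) ≤ m)]
  exact h.re_ofReal

theorem analyticOnNhd_discMoment : AnalyticOnNhd ℝ discMoment (Ioo (-2) 1) := by
  rintro k ⟨hk, hk'⟩
  have hΓ : ∀ g : ℝ → ℝ, AnalyticAt ℝ g k → 0 < g k → AnalyticAt ℝ (fun x => Real.Gamma (g x)) k :=
    fun g hg hpos => (analyticAt_realGamma hpos).fun_comp hg
  have h1 := hΓ (fun k => 1 + k / 2) (by fun_prop) (by linarith)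
  have h2 := hΓ (fun k => 1 - k) (by fun_prop) (by linarith)
  have h3 := hΓ (fun k => 2 - k / 2) (by fun_prop) (by linarith)
  have h4 := hΓ (fun k => 1 - k / 2) (by fun_prop) (by linarith)
  have := Real.Gamma_pos_of_pos (show 0 < 2 - k / 2 by linarith)
  have := Real.Gamma_pos_of_pos (show 0 < 1 - k / 2 by linarith)
  exact (h1.mul h2).div (h3.mul (h4.pow 2)) (by positivity)

theorem ballTransform_norm (R : ℝ) (z : ℂ) : ballTransform R (‖z‖ : ℂ) = ballTransform R z :=
  ballTransform_eq_of_norm_eq R (by rw [Complex.norm_real, norm_norm])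

theorem absCosMoment_mul_lintegral_enorm_sq_ballTransform_mul_norm_rpow {R k : ℝ} (hR : 0 ≤ R)
    (hk0 : 0 < k) (hk2 : k < 2) :
    ENNReal.ofReal ((2 * Real.pi) ^ k *
        (Real.Gamma (k / 2) * Real.Gamma (1 - k / 2) / Real.Gamma (1 + k))) *
      (absCosMoment k * ∫⁻ z : ℂ, ‖ballTransform R z‖ₑ ^ 2 * ENNReal.ofReal (‖z‖ ^ k)) =
    ENNReal.ofReal (2 * Real.pi) *
      (ENNReal.ofReal (2 ^ (1 - k) / k * (R ^ (2 - k) / (2 - k))) * absCosMoment (-k)) := by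
  have hmeas : Measurable fun r : ℝ => ballTransform R (r : ℂ) :=
    ((continuous_ballTransform R).comp Complex.continuous_ofReal).measurable
  have h := two_pi_mul_lintegral_radial_mul_abs_re_rpow
    (hmeas.enorm.pow_const 2) k
  simp_rw [ballTransform_norm] at h
  simp_rw [← h, ← lintegral_abs_re_rpow_mul_enorm_sq_ballTransform hR hk0 hk2, mul_left_comm,
    mul_comm (ENNReal.ofReal (|_| ^ k))]

theorem mul_discMoment_eq {k : ℝ} (hk0 : 0 < k) (hk1 : k < 1) :
    (2 * Real.pi) ^ k * (Real.Gamma (k / 2) * Real.Gamma (1 - k / 2) / Real.Gamma (1 + k)) *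
      (2 * Real.pi * 2 ^ (-k) * Real.Gamma (1 + k) / Real.Gamma (1 + k / 2) ^ 2) * discMoment k =
    Real.pi * (2 * Real.pi * (2 ^ (1 - k) / k * (Real.pi⁻¹ ^ (2 - k) / (2 - k)) *
      (2 * Real.pi * 2 ^ k * Real.Gamma (1 - k) / Real.Gamma (1 - k / 2) ^ 2))) := by
  have hpi := Real.pi_pos
  have := Real.Gamma_pos_of_pos (show 0 < k / 2 by linarith)
  have hΓ2 := Real.Gamma_pos_of_pos (show 0 < 1 - k / 2 by linarith)
  have hΓ3 := Real.Gamma_pos_of_pos (show 0 < 1 + k by linarith)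
  have h2k : 0 < 2 - k := by linarith
  have hrec1 : Real.Gamma (1 + k / 2) = k / 2 * Real.Gamma (k / 2) := by
    rw [add_comm, Real.Gamma_add_one (by positivity)]
  have hrec2 : Real.Gamma (2 - k / 2) = (2 - k) / 2 * Real.Gamma (1 - k / 2) := by
    rw [show 2 - k / 2 = 1 - k / 2 + 1 by ring, Real.Gamma_add_one (by linarith)]
    ring
  have hpow1 : (2 : ℝ) ^ (1 - k) = 2 / 2 ^ k := by rw [Real.rpow_sub two_pos, Real.rpow_one]
  have hpow2 : Real.pi⁻¹ ^ (2 - k) = Real.pi ^ k / Real.pi ^ 2 := by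
    rw [Real.inv_rpow hpi.le, ← Real.rpow_neg hpi.le, neg_sub, Real.rpow_sub hpi, Real.rpow_two]
  rw [discMoment, hrec1, hrec2, hpow1, hpow2, Real.rpow_neg two_pos.le,
    Real.mul_rpow two_pos.le hpi.le]
  generalize Real.Gamma (1 - k / 2) = G at hΓ2 ⊢
  generalize Real.Gamma (1 + k) = G' at hΓ3 ⊢
  field_simp

theorem lintegral_enorm_sq_ballTransform_mul_norm_rpow {k : ℝ} (hk0 : 0 < k) (hk1 : k < 1) :
    ENNReal.ofReal Real.pi *
      ∫⁻ z : ℂ, ‖ballTransform Real.pi⁻¹ z‖ₑ ^ 2 * ENNReal.ofReal (‖z‖ ^ k) =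
      ENNReal.ofReal (discMoment k) := by
  have h := absCosMoment_mul_lintegral_enorm_sq_ballTransform_mul_norm_rpow
    (R := Real.pi⁻¹) (by positivity) hk0 (by linarith)
  have hΓ1 := Real.Gamma_pos_of_pos (show 0 < k / 2 by linarith)
  have hΓ2 := Real.Gamma_pos_of_pos (show 0 < 1 - k / 2 by linarith)
  have hΓ3 := Real.Gamma_pos_of_pos (show 0 < 1 + k by linarith)
  have hΓ4 := Real.Gamma_pos_of_pos (show 0 < 1 + k / 2 by linarith)
  have h2k : 0 < 2 - k := by linarith
  rw [absCosMoment_eq (by linarith), absCosMoment_eq (by linarith), neg_neg, neg_div,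
    ← sub_eq_add_neg, ← sub_eq_add_neg, ← mul_assoc, ← ENNReal.ofReal_mul (by positivity),
    ← ENNReal.ofReal_mul (by positivity), ← ENNReal.ofReal_mul (by positivity)] at h
  set c := (2 * Real.pi) ^ k *
    (Real.Gamma (k / 2) * Real.Gamma (1 - k / 2) / Real.Gamma (1 + k)) *
      (2 * Real.pi * 2 ^ (-k) * Real.Gamma (1 + k) / Real.Gamma (1 + k / 2) ^ 2)
  have hc : 0 < c := by positivity
  rw [← ENNReal.mul_right_inj (ENNReal.ofReal_ne_zero_iff.2 hc) ENNReal.ofReal_ne_top,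
    mul_left_comm, h, ← ENNReal.ofReal_mul Real.pi_pos.le, ← ENNReal.ofReal_mul hc.le,
    mul_discMoment_eq hk0 hk1]

theorem lintegral_enorm_sq_ballTransform_mul_norm {R : ℝ} (hR : 0 < R) :
    ∫⁻ z : ℂ, ‖ballTransform R z‖ₑ ^ 2 * ENNReal.ofReal ‖z‖ = ⊤ := by
  have h := absCosMoment_mul_lintegral_enorm_sq_ballTransform_mul_norm_rpow hR.le one_pos one_lt_two
  simp_rw [Real.rpow_one] at h
  rw [absCosMoment_neg_one,
    ENNReal.mul_top (ENNReal.ofReal_ne_zero_iff.2 (by norm_num; positivity)),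
    ENNReal.mul_top (ENNReal.ofReal_ne_zero_iff.2 Real.two_pi_pos)] at h
  by_contra hne
  have hcos : absCosMoment 1 ≠ ⊤ := by
    rw [absCosMoment_eq (by norm_num)]
    exact ENNReal.ofReal_ne_top
  exact ENNReal.mul_ne_top ENNReal.ofReal_ne_top (ENNReal.mul_ne_top hcos hne) h

theorem setLIntegral_closedBall_norm_rpow {R a : ℝ} (hR : 0 ≤ R) (ha : -2 < a) :
    ∫⁻ z in closedBall (0 : ℂ) R, ENNReal.ofReal (‖z‖ ^ a) =
      ENNReal.ofReal (R ^ (2 + a) / (2 + a)) * ENNReal.ofReal (2 * Real.pi) := by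
  rw [setLIntegral_closedBall_eq_lintegral_mul,
    lintegral_radial_mul_norm_rpow (measurable_one.indicator measurableSet_Iic),
    lintegral_rpow_mul_indicator_Iic hR (by linarith), show 1 + a + 1 = 2 + a by ring]

theorem lintegral_mul_norm_rpow_ne_top {F : ℂ → ℝ≥0∞} {C : ℝ≥0∞} (hC : C ≠ ⊤)
    (hFC : ∀ z, F z ≤ C) (hF : ∫⁻ z, F z ≠ ⊤) {k : ℝ} (hk : -2 < k) (hk0 : k ≤ 0) :
    ∫⁻ z, F z * ENNReal.ofReal (‖z‖ ^ k) ≠ ⊤ := by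
  have hball : MeasurableSet (closedBall (0 : ℂ) 1) := measurableSet_closedBall
  have hnear : ∫⁻ z in closedBall 0 1, F z * ENNReal.ofReal (‖z‖ ^ k) ≤
      C * ∫⁻ z in closedBall (0 : ℂ) 1, ENNReal.ofReal (‖z‖ ^ k) := by
    rw [← lintegral_const_mul' _ _ hC]
    exact lintegral_mono fun z => mul_le_mul_left (hFC z) _
  have hfar : ∫⁻ z in (closedBall 0 1)ᶜ, F z * ENNReal.ofReal (‖z‖ ^ k) ≤ ∫⁻ z, F z := by
    refine (setLIntegral_mono' hball.compl fun z hz => ?_).trans (setLIntegral_le_lintegral _ _)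
    have hz1 : 1 ≤ ‖z‖ := by
      rw [mem_compl_iff, mem_closedBall_zero_iff, not_le] at hz
      exact hz.le
    exact mul_le_of_le_one_right'
      (ENNReal.ofReal_le_one.2 (Real.rpow_le_one_of_one_le_of_nonpos hz1 hk0))
  rw [← lintegral_add_compl _ hball]
  refine ENNReal.add_ne_top.2 ⟨ne_top_of_le_ne_top ?_ hnear, ne_top_of_le_ne_top hF hfar⟩
  rw [setLIntegral_closedBall_norm_rpow zero_le_one hk]
  exact ENNReal.mul_ne_top hC (ENNReal.mul_ne_top ENNReal.ofReal_ne_top ENNReal.ofReal_ne_top)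

theorem lintegral_enorm_sq_ballTransform_mul_norm_rpow_ne_top {k : ℝ} (hk : -2 < k) (hk1 : k < 1) :
    ENNReal.ofReal Real.pi *
      ∫⁻ z : ℂ, ‖ballTransform Real.pi⁻¹ z‖ₑ ^ 2 * ENNReal.ofReal (‖z‖ ^ k) ≠ ⊤ := by
  rcases le_or_gt k 0 with hk0 | hk0
  · refine ENNReal.mul_ne_top ENNReal.ofReal_ne_top (lintegral_mul_norm_rpow_ne_top
      (C := ENNReal.ofReal (volume.real (closedBall (0 : ℂ) Real.pi⁻¹)) ^ 2)
      (ENNReal.pow_ne_top ENNReal.ofReal_ne_top) (fun z => ?_) ?_ hk hk0)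
    · rw [← ofReal_norm]
      gcongr
      exact norm_ballTransform_le _ z
    · rw [lintegral_enorm_sq_ballTransform]
      exact measure_closedBall_lt_top.ne
  · rw [lintegral_enorm_sq_ballTransform_mul_norm_rpow hk0 hk1]
    exact ENNReal.ofReal_ne_top

end DiscMoments

section RealPowerMoments

open Set ProbabilityTheory

variable {Ω : Type*} [MeasurableSpace Ω] {P : Measure Ω} {X : Ω → ℝ}

-- The moments `𝔼[X ^ k]` are the values at `k` of the moment generating function of `log X`.
theorem analyticOnNhd_integral_rpow (hX : ∀ᵐ ω ∂P, 0 < X ω) {s : Set ℝ} (hs : IsOpen s)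
    (hint : ∀ k ∈ s, Integrable (fun ω => X ω ^ k) P) :
    AnalyticOnNhd ℝ (fun k => ∫ ω, X ω ^ k ∂P) s := by
  have hexp : ∀ k : ℝ, (fun ω => Real.exp (k * Real.log (X ω))) =ᵐ[P] fun ω => X ω ^ k := by
    intro k
    filter_upwards [hX] with ω hω
    rw [Real.rpow_def_of_pos hω, mul_comm]
  have hmgf : mgf (fun ω => Real.log (X ω)) P = fun k => ∫ ω, X ω ^ k ∂P :=
    funext fun k => integral_congr_ae (hexp k)
  rw [← hmgf]
  exact analyticOnNhd_mgf.mono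
    (interior_maximal (fun k hk => (hint k hk).congr (hexp k).symm) hs)

theorem lintegral_rpow_eq_top_of_one_le [IsFiniteMeasure P]
    (hX : ∫⁻ ω, ENNReal.ofReal (X ω) ∂P = ⊤) {k : ℝ} (hk : 1 ≤ k) :
    ∫⁻ ω, ENNReal.ofReal (X ω ^ k) ∂P = ⊤ := by
  have hle : ∀ ω, ENNReal.ofReal (X ω) ≤ 1 + ENNReal.ofReal (X ω ^ k) := by
    intro ω
    rcases le_total (X ω) 1 with h | h
    · exact le_add_right (ENNReal.ofReal_le_one.2 h)
    · exact le_add_left (ENNReal.ofReal_le_ofReal (Real.self_le_rpow_of_one_le h hk))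
  have htop : ∫⁻ ω, (1 + ENNReal.ofReal (X ω ^ k)) ∂P = ⊤ :=
    top_le_iff.1 (hX.symm.trans_le (lintegral_mono hle))
  rw [lintegral_add_left measurable_const, lintegral_one] at htop
  by_contra hne
  exact ENNReal.add_ne_top.2 ⟨measure_ne_top P univ, hne⟩ htop

end RealPowerMoments

section Law

open Set ProbabilityTheory
open scoped ENNReal

variable {Ω : Type*} [MeasurableSpace Ω] {P : Measure Ω}
  {Z : Ω → EuclideanSpace ℝ (Fin 2)} {u : EuclideanSpace ℝ (Fin 2)}

theorem lintegral_comp_norm_sub_of_hasLaw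
    (hZ : HasLaw Z (volume.withDensity fun v => ENNReal.ofReal (ballDensity 2 u v)) P)
    {g : ℝ → ℝ≥0∞} (hg : Measurable g) :
    ∫⁻ ω, g ‖Z ω - u‖ ∂P =
      ENNReal.ofReal Real.pi * ∫⁻ z : ℂ, ‖ballTransform Real.pi⁻¹ z‖ₑ ^ 2 * g ‖z‖ := by
  have hgm : Measurable fun v : EuclideanSpace ℝ (Fin 2) => g ‖v - u‖ := by fun_prop
  rw [hZ.lintegral_comp hgm.aemeasurable, lintegral_withDensity_eq_lintegral_mul _
    (measurable_ballDensity one_le_two u).ennreal_ofReal hgm]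
  simp_rw [Pi.mul_apply, ofReal_ballDensity one_le_two, ballRadius_two, mul_assoc]
  rw [lintegral_const_mul' _ _ ENNReal.ofReal_ne_top, lintegral_sub_right_eq_self
      (fun v : EuclideanSpace ℝ (Fin 2) => ‖ballTransform Real.pi⁻¹ v‖ₑ ^ 2 * g ‖v‖) u,
    ← Complex.orthonormalBasisOneI.repr.measurePreserving.lintegral_comp_emb
      Complex.orthonormalBasisOneI.repr.toHomeomorph.measurableEmbedding]
  simp_rw [ballTransform_map, LinearIsometryEquiv.norm_map]

theorem ae_norm_sub_pos_of_hasLaw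
    (hZ : HasLaw Z (volume.withDensity fun v => ENNReal.ofReal (ballDensity 2 u v)) P) :
    ∀ᵐ ω ∂P, 0 < ‖Z ω - u‖ := by
  have hne : ∀ᵐ ω ∂P, Z ω ≠ u :=
    (hZ.ae_iff (measurableSet_singleton u).compl.mem).2
      ((withDensity_absolutelyContinuous _ _).ae_le (Measure.ae_ne volume u))
  filter_upwards [hne] with ω hω
  exact norm_pos_iff.2 (sub_ne_zero.2 hω)

theorem integrable_norm_sub_rpow_of_hasLaw
    (hZ : HasLaw Z (volume.withDensity fun v => ENNReal.ofReal (ballDensity 2 u v)) P)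
    {k : ℝ} (hk : -2 < k) (hk1 : k < 1) : Integrable (fun ω => ‖Z ω - u‖ ^ k) P := by
  have hm := hZ.aemeasurable
  rw [← lintegral_ofReal_ne_top_iff_integrable (AEMeasurable.aestronglyMeasurable (by fun_prop))
      (.of_forall fun ω => Real.rpow_nonneg (norm_nonneg _) _),
    lintegral_comp_norm_sub_of_hasLaw hZ (g := fun r => ENNReal.ofReal (r ^ k)) (by fun_prop)]
  exact lintegral_enorm_sq_ballTransform_mul_norm_rpow_ne_top hk hk1

theorem integral_norm_sub_rpow_of_hasLaw_of_pos
    (hZ : HasLaw Z (volume.withDensity fun v => ENNReal.ofReal (ballDensity 2 u v)) P)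
    {k : ℝ} (hk0 : 0 < k) (hk1 : k < 1) : ∫ ω, ‖Z ω - u‖ ^ k ∂P = discMoment k := by
  have hm := hZ.aemeasurable
  rw [integral_eq_lintegral_of_nonneg_ae (.of_forall fun ω => Real.rpow_nonneg (norm_nonneg _) _)
      (AEMeasurable.aestronglyMeasurable (by fun_prop)),
    lintegral_comp_norm_sub_of_hasLaw hZ (g := fun r => ENNReal.ofReal (r ^ k)) (by fun_prop),
    lintegral_enorm_sq_ballTransform_mul_norm_rpow hk0 hk1,
    ENNReal.toReal_ofReal (discMoment_pos (by linarith) hk1).le]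

theorem integral_norm_sub_rpow_of_hasLaw
    (hZ : HasLaw Z (volume.withDensity fun v => ENNReal.ofReal (ballDensity 2 u v)) P)
    {k : ℝ} (hk : -2 < k) (hk1 : k < 1) : ∫ ω, ‖Z ω - u‖ ^ k ∂P = discMoment k := by
  have hanalytic : AnalyticOnNhd ℝ (fun k : ℝ => ∫ ω, ‖Z ω - u‖ ^ k ∂P) (Ioo (-2) 1) :=
    analyticOnNhd_integral_rpow (ae_norm_sub_pos_of_hasLaw hZ) isOpen_Ioo
      fun k hk => integrable_norm_sub_rpow_of_hasLaw hZ hk.1 hk.2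
  have hlocal : (fun k : ℝ => ∫ ω, ‖Z ω - u‖ ^ k ∂P) =ᶠ[nhds (1 / 2)] discMoment := by
    filter_upwards [Ioo_mem_nhds (show (0 : ℝ) < 1 / 2 by norm_num) one_half_lt_one] with k hk
    exact integral_norm_sub_rpow_of_hasLaw_of_pos hZ hk.1 hk.2
  exact hanalytic.eqOn_of_preconnected_of_eventuallyEq analyticOnNhd_discMoment isPreconnected_Ioo
    (by norm_num) hlocal ⟨hk, hk1⟩

theorem lintegral_norm_sub_rpow_of_hasLaw [IsFiniteMeasure P]
    (hZ : HasLaw Z (volume.withDensity fun v => ENNReal.ofReal (ballDensity 2 u v)) P)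
    {k : ℝ} (hk : 1 ≤ k) : ∫⁻ ω, ENNReal.ofReal (‖Z ω - u‖ ^ k) ∂P = ⊤ := by
  refine lintegral_rpow_eq_top_of_one_le ?_ hk
  rw [lintegral_comp_norm_sub_of_hasLaw hZ ENNReal.measurable_ofReal,
    lintegral_enorm_sq_ballTransform_mul_norm (by positivity),
    ENNReal.mul_top (ENNReal.ofReal_ne_zero_iff.2 Real.pi_pos)]

end Law

theorem proposition1 :
    (∀ d : ℕ, 1 ≤ d →
      IsGloballyMostRepulsive (ballKernel d) ∧
      ∀ u : EuclideanSpace ℝ (Fin d),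
        ballKernel d u u = ((1 / Real.pi : ℝ) : ℂ) ∧
        (∀ v, pushedOutIntensity (ballKernel d) u v = ballDensity d u v) ∧
        IsProbabilityDensity (ballDensity d u)) ∧
    (∀ u : EuclideanSpace ℝ (Fin 2),
      (∀ v, v ≠ u →
        ballDensity 2 u v = besselJ 1 (2 * ‖v - u‖) ^ 2 / (Real.pi * ‖v - u‖ ^ 2)) ∧
      ballDensity 2 u u = 1 / Real.pi ∧
      ∀ (Ω : Type*) [MeasurableSpace Ω] (P : Measure Ω) [IsProbabilityMeasure P]
        (Z : Ω → EuclideanSpace ℝ (Fin 2)),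
        ProbabilityTheory.HasLaw Z
          (volume.withDensity (fun v => ENNReal.ofReal (ballDensity 2 u v))) P →
        (∀ k : ℝ, -2 < k → k < 1 →
          Integrable (fun ω => ‖Z ω - u‖ ^ k) P ∧
          ∫ ω, ‖Z ω - u‖ ^ k ∂P =
            Real.Gamma (1 + k / 2) * Real.Gamma (1 - k) /
              (Real.Gamma (2 - k / 2) * Real.Gamma (1 - k / 2) ^ 2)) ∧
        (∀ k : ℝ, 1 ≤ k → ∫⁻ ω, ENNReal.ofReal (‖Z ω - u‖ ^ k) ∂P = ⊤)) := by
  refine ⟨fun d hd => ⟨isGloballyMostRepulsive_ballKernel hd, fun u => ⟨ballKernel_self hd u,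
    pushedOutIntensity_ballKernel hd u, isProbabilityDensity_ballDensity hd u⟩⟩, fun u =>
    ⟨fun v hv => ballDensity_two_of_ne hv, ballDensity_self one_le_two u, ?_⟩⟩
  intro Ω _ P _ Z hZ
  exact ⟨fun k hk hk1 => ⟨integrable_norm_sub_rpow_of_hasLaw hZ hk hk1,
    integral_norm_sub_rpow_of_hasLaw hZ hk hk1⟩, fun k hk =>
    lintegral_norm_sub_rpow_of_hasLaw hZ hk⟩
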